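/- \textbf{The base category.} Let $\mathbb C$ be the free category on the following graph, modulo the equations below; here $n,m\in\mathbb N$, $a,b\in\{1,\dots,n\}$, $c,d\in\{1,\dots,m\}$. Objects, with their dimension: $\star$ (dimension $0$); $[n]$ (dimension $1$); $\pi^l_n,\pi^r_n,\heartsuit_n,\tau_n,o_{n,a,b},\nu_n,\iota_{n,a}$ (dimension $2$); $\pi_n$ (dimension $3$); $\tau_{n,a,m,c,d}$ (dimension $4$). Edges: $s_1,\dots,s_n:\star\to[n]$; $s,t:[n]\to v$ for $v\in\{\pi^l_n,\pi^r_n,\heartsuit_n,\tau_n,o_{n,a,b}\}$; $t:[n]\to v$ and $s:[n+1]\to v$ for $v\in\{\nu_n,\iota_{n,a}\}$; $l:\pi^l_n\to\pi_n$, $r:\pi^r_n\to\pi_n$; $\rho:\iota_{n,a}\to\tau_{n,a,m,c,d}$ and $\epsilon:o_{m,c,d}\to\tau_{n,a,m,c,d}$. Equations: $s\circ s_i=t\circ s_i$ for $1\le i\le n$ (for every $v$ of dimension $2$ as above, $n$ being the arity of the source of $t$); $l\circ t=r\circ t$; $\rho\circ t\circ s_a=\epsilon\circ t\circ s_c$;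 $\rho\circ s\circ s_{n+1}=\epsilon\circ s\circ s_d$. For a presheaf $U$ on $\mathbb C$, $f:c\to c'$ and $x\in U(c')$, write $x\cdot f=U(f)(x)\in U(c)$. The elements of $U(\star)$ are the \emph{channels} of $U$, those of the $U[n]$ its \emph{agents}, and elements of dimension $\ge 2$ its action elements. $U$ is \emph{finite} if its total set of elements is finite. A \emph{position} is a finite presheaf which is empty except perhaps at $\star$ and the $[n]$. A map is \emph{$1$-injective} if it is injective in all strictly positive dimensions; morphisms of positions are the $1$-injective maps. The \emph{interface} $I_X$ of $X$ is the subpresheaf of its channels. Objects of $\mathbb C$ are identified with the corresponding representable presheaves. \textbf{Traces.} The \emph{seeds} are the following cospans $Y\xrightarrow{s}M\xleftarrow{t}X$ ($X$ initial, $Y$ final): for each $v$ of dimension $2$, the cospan given by the edges $s$ and $t$ into $v$; $[n]\mid[n]\xrightarrow{[l s,\,r s]}\pi_n\xleftarrow{\,l t\,}[n]$, where $[n]\mid[n]$ consists of two $n$-ary agents sharing all their channels in order; and $Y\xrightarrow{[\epsilon s,\,\rho s]}\tau_{n,a,m,c,d}\xleftarrow{[\epsilon t,\,\rho t]}X$,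 where $X$ consists of an $m$-ary agent $x$ and an $n$-ary agent $y$ subject to $x\cdot s_c=y\cdot s_a$, and $Y$ of an $m$-ary agent $x$ and an $(n+1)$-ary agent $y$ subject to $x\cdot s_c=y\cdot s_a$ and $x\cdot s_d=y\cdot s_{n+1}$. An \emph{action} is any cospan $Y'\to M'\leftarrow X'$ obtained from a seed by pushing out $Y$, $M$ and $X$ along one morphism of positions $I_X\to Z$ (with the induced legs). A \emph{trace} is a cospan $Y\to U\leftarrow X$ that is isomorphic, as a diagram, to a finite, possibly empty, composite of actions, where composition of cospans is by pushout and the empty composites are the identity cospans of positions. \textbf{The causal graph.} A \emph{core} of $U$ is an element of dimension $>1$ that is not of the form $y\cdot f$ for any element $y$ of higher dimension. The \emph{sources} (resp.\ \emph{targets}) of a core $\mu$ are the agents of the form $\mu\cdot f\cdot s$ (resp.\ $\mu\cdot f\cdot t$) for some $f$; a channel $a$ is \emph{created} by $\mu$ if $\mu$ lies over some $\nu_n$ or $\iota_{n,i}$ and $a=\mu\cdot s\cdot s_{n+1}$. The \emph{causal graph} $G_U$ has as vertices the channels, agents and cores of $U$, and as edges: $x\to x\cdot s_i$ for each agent $x\in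 U[n]$ and $1\le i\le n$; $x\to\mu$ for each core $\mu$ and each source of, or channel created by, $\mu$; $\mu\to x$ for each core $\mu$ and target $x$ of $\mu$. $G_U$ is \emph{linear} if no agent or channel has edges to two distinct cores and no agent has edges from two distinct cores; it is \emph{acyclic} if it has no (nontrivial) directed cycle. An agent of $U$ is \emph{initial} (resp.\ \emph{final}) if it is not of the form $\mu\cdot s$ (resp.\ $\mu\cdot t$) for any action element $\mu$ of $U$. A channel is initial if it is created by no core; all channels are final. $U$ is \emph{locally $1$-injective} if for every seed $Y\to M\leftarrow X$ and every core $\mu\in U(M)$, any two distinct elements of $M$ identified by the Yoneda morphism $\mu:M\to U$ are in the image of $I_X$. \textbf{Theorem.} Let $Y\overset{s}{\hookrightarrow}U\overset{t}{\hookleftarrow}X$ be a cospan of monomorphisms between finite presheaves on $\mathbb C$. It is a trace if and only if (i) $U$ is locally $1$-injective; (ii) the image of $X$ consists exactly of the initial agents and channels of $U$; (iii) the image of $Y$ consists exactly of the final agents and channels of $U$; and (iv) $G_U$ is linear and acyclic. -/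

import Mathlib

open CategoryTheory CategoryTheory.Limits Opposite

namespace PiTrace

/-! ## The base category -/

/-- The seven families of two-dimensional shapes: left and right half-fork `πˡₙ`, `πʳₙ`, tick `♡ₙ`,
silent action `τₙ`, output `o_{n,a,b}` (of the `b`-th channel on the `a`-th channel),
channel creation `νₙ` and input `ι_{n,a}` (on the `a`-th channel).
Channel indices `1, …, n` are elements of `Fin n`. -/
inductive Shape : Type
  | forkL (n : ℕ)
  | forkR (n : ℕ)
  | tick (n : ℕ)
  | tau (n : ℕ)
  | out (n : ℕ) (a b : Fin n)
  | nu (n : ℕ)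
  | inp (n : ℕ) (a : Fin n)

namespace Shape

/-- The arity of the agent performing the action. -/
abbrev arity : Shape → ℕ
  | forkL n => n
  | forkR n => n
  | tick n => n
  | tau n => n
  | out n _ _ => n
  | nu n => n
  | inp n _ => n

/-- The number of channels learnt by the agent: one for `νₙ` and `ι_{n,a}`, otherwise none. -/
abbrev fresh : Shape → ℕ
  | forkL _ => 0
  | forkR _ => 0
  | tick _ => 0
  | tau _ => 0
  | out _ _ _ => 0
  | nu _ => 1
  | inp _ _ => 1

/-- The arity of the agent after the action. -/
abbrev finalArity (v : Shape) : ℕ := v.arity + v.fresh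

end Shape

/-- The vertices of the generating graph: `⋆`, the agents `[n]`, the two-dimensional shapes,
the forks `πₙ` and the synchronisations `τ_{n,a,m,c,d}`. -/
inductive Ob : Type
  | star
  | agent (n : ℕ)
  | act (v : Shape)
  | fork (n : ℕ)
  | sync (n : ℕ) (a : Fin n) (m : ℕ) (c d : Fin m)

/-- The dimension of an object. -/
def Ob.dim : Ob → ℕ
  | star => 0
  | agent _ => 1
  | act _ => 2
  | fork _ => 3
  | sync _ _ _ _ _ => 4

/-- The edges of the generating graph: `s₁, …, sₙ : ⋆ → [n]`; for each two-dimensional shape `v`,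
`t` from its performing agent and `s` from its resulting agent; `l : πˡₙ → πₙ`, `r : πʳₙ → πₙ`;
`ρ : ι_{n,a} → τ_{n,a,m,c,d}` and `ε : o_{m,c,d} → τ_{n,a,m,c,d}`. -/
inductive Edge : Ob → Ob → Type
  | chan (n : ℕ) (i : Fin n) : Edge .star (.agent n)
  | src (v : Shape) : Edge (.agent v.finalArity) (.act v)
  | tgt (v : Shape) : Edge (.agent v.arity) (.act v)
  | left (n : ℕ) : Edge (.act (.forkL n)) (.fork n)
  | right (n : ℕ) : Edge (.act (.forkR n)) (.fork n)
  | recv (n : ℕ) (a : Fin n) (m : ℕ) (c d : Fin m) :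
      Edge (.act (.inp n a)) (.sync n a m c d)
  | send (n : ℕ) (a : Fin n) (m : ℕ) (c d : Fin m) :
      Edge (.act (.out m c d)) (.sync n a m c d)

instance : Quiver Ob := ⟨Edge⟩

/-- A generating edge as a morphism of the free category. -/
def gen {x y : Ob} (e : Edge x y) : (Paths.of Ob).obj x ⟶ (Paths.of Ob).obj y :=
  (Paths.of Ob).map e

/-- The defining equations. (Composition is written in diagrammatic order.) -/
inductive Rel : HomRel (Paths Ob)
  /-- `s ∘ sᵢ = t ∘ sᵢ` for all `i ≤ n`. -/
  | src_tgt (v : Shape) (i : Fin v.arity) :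
      Rel (gen (.chan v.finalArity (Fin.castAdd v.fresh i)) ≫ gen (.src v))
        (gen (.chan v.arity i) ≫ gen (.tgt v))
  /-- `l ∘ t = r ∘ t`. -/
  | fork (n : ℕ) :
      Rel (gen (.tgt (.forkL n)) ≫ gen (.left n)) (gen (.tgt (.forkR n)) ≫ gen (.right n))
  /-- `ρ ∘ t ∘ s_a = ε ∘ t ∘ s_c`. -/
  | sync_subject (n : ℕ) (a : Fin n) (m : ℕ) (c d : Fin m) :
      Rel (gen (.chan n a) ≫ gen (.tgt (.inp n a)) ≫ gen (.recv n a m c d))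
        (gen (.chan m c) ≫ gen (.tgt (.out m c d)) ≫ gen (.send n a m c d))
  /-- `ρ ∘ s ∘ s_{n+1} = ε ∘ s ∘ s_d`. -/
  | sync_object (n : ℕ) (a : Fin n) (m : ℕ) (c d : Fin m) :
      Rel (gen (.chan (n + 1) (Fin.last n)) ≫ gen (.src (.inp n a)) ≫ gen (.recv n a m c d))
        (gen (.chan m d) ≫ gen (.src (.out m c d)) ≫ gen (.send n a m c d))

/-- The base category: the free category on the generating graph modulo the equations. -/
abbrev Base : Type := CategoryTheory.Quotient Rel

/-- An object of the base category. -/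
abbrev ob (x : Ob) : Base := (CategoryTheory.Quotient.functor Rel).obj ((Paths.of Ob).obj x)

/-- A generating edge as a morphism of the base category. -/
def arr {x y : Ob} (e : Edge x y) : ob x ⟶ ob y := (CategoryTheory.Quotient.functor Rel).map (gen e)

/-- The dimension of an object of the base category. -/
def dim (c : Base) : ℕ := Ob.dim c.as

theorem rel_src_tgt (v : Shape) (i : Fin v.arity) :
    arr (.chan v.finalArity (Fin.castAdd v.fresh i)) ≫ arr (.src v)
      = arr (.chan v.arity i) ≫ arr (.tgt v) := by
  simp only [arr, ← Functor.map_comp]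
  exact CategoryTheory.Quotient.sound _ (.src_tgt v i)

theorem rel_fork (n : ℕ) :
    arr (.tgt (.forkL n)) ≫ arr (.left n) = arr (.tgt (.forkR n)) ≫ arr (.right n) := by
  simp only [arr, ← Functor.map_comp]
  exact CategoryTheory.Quotient.sound _ (.fork n)

theorem rel_sync_subject (n : ℕ) (a : Fin n) (m : ℕ) (c d : Fin m) :
    arr (.chan n a) ≫ arr (.tgt (.inp n a)) ≫ arr (.recv n a m c d)
      = arr (.chan m c) ≫ arr (.tgt (.out m c d)) ≫ arr (.send n a m c d) := by
  simp only [arr, ← Functor.map_comp]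
  exact CategoryTheory.Quotient.sound _ (.sync_subject n a m c d)

theorem rel_sync_object (n : ℕ) (a : Fin n) (m : ℕ) (c d : Fin m) :
    arr (.chan (n + 1) (Fin.last n)) ≫ arr (.src (.inp n a)) ≫ arr (.recv n a m c d)
      = arr (.chan m d) ≫ arr (.src (.out m c d)) ≫ arr (.send n a m c d) := by
  simp only [arr, ← Functor.map_comp]
  exact CategoryTheory.Quotient.sound _ (.sync_object n a m c d)

theorem Edge.dim_lt {x y : Ob} (e : Edge x y) : x.dim < y.dim := by
  cases e <;> simp [Ob.dim]

theorem path_dim_le {x y : Ob} (p : Quiver.Path x y) : x.dim ≤ y.dim := by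
  induction p with
  | nil => exact le_rfl
  | cons _ e ih => exact ih.trans (Edge.dim_lt e).le

/-- Morphisms do not decrease dimension. -/
theorem dim_le_of_hom {c d : Base} (f : c ⟶ d) : dim c ≤ dim d := by
  obtain ⟨p, rfl⟩ := (CategoryTheory.Quotient.functor Rel).map_surjective f
  exact path_dim_le p

/-! ## Presheaves and positions -/

/-- Presheaves on the base category. -/
abbrev Psh : Type 1 := Baseᵒᵖ ⥤ Type

/-- The set of elements of `U` over `c`. -/
abbrev El (U : Psh) (c : Base) : Type := U.obj (op c)

/-- The element `x · f`. -/
def res (U : Psh) {c d : Base} (f : c ⟶ d) (x : El U d) : El U c := U.map f.op x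

/-- A presheaf is finite if its set of elements is finite. -/
def IsFinite (U : Psh) : Prop := Finite (Σ c : Base, El U c)

/-- The agents of a presheaf, of all arities. -/
abbrev Agent (U : Psh) : Type := Σ n : ℕ, El U (ob (.agent n))

/-- The channels of a presheaf. -/
abbrev Channel (U : Psh) : Type := El U (ob .star)

/-- Positions: finite presheaves empty except perhaps over `⋆` and the `[n]`. -/
def IsPosition (X : Psh) : Prop :=
  IsFinite X ∧ ∀ c : Base, 1 < dim c → IsEmpty (El X c)

/-- Maps that are injective in all strictly positive dimensions. -/
def OneInjective {X Y : Psh} (h : X ⟶ Y) : Prop :=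
  ∀ c : Base, 0 < dim c → Function.Injective (h.app (op c))

/-- The interface of `F` as a subpresheaf: it consists solely of the channels of `F`. -/
def channels (F : Psh) : Subfunctor F where
  obj c := {_x | dim c.unop = 0}
  map i _ hx := Nat.le_zero.mp ((dim_le_of_hom i.unop).trans (le_of_eq hx))

/-- The interface `I_F` of a presheaf. -/
abbrev interface (F : Psh) : Psh := (channels F).toFunctor

/-- The inclusion `I_F ⟶ F`. -/
abbrev interfaceι (F : Psh) : interface F ⟶ F := (channels F).ι

/-! ## Seeds -/

/-- The representable presheaf on `c`. -/
abbrev rep (c : Base) : Psh := yoneda.obj c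

/-- The map from `p` copies of `⋆` to `[m]` picking the channels `a₁, …, a_p`. -/
noncomputable def pick {p m : ℕ} (a : Fin p → Fin m) :
    (∐ fun _ : Fin p => rep (ob .star)) ⟶ rep (ob (.agent m)) :=
  Sigma.desc fun k => yoneda.map (arr (.chan m (a k)))

/-- The position made of an `m`-ary agent `x` and an `n`-ary agent `y`, quotiented by the equations
`x · s_{a k} = y · s_{b k}` for all `k`. -/
noncomputable abbrev twoAgents {p m n : ℕ} (a : Fin p → Fin m) (b : Fin p → Fin n) : Psh :=
  pushout (pick a) (pick b)

/-- The map out of `twoAgents a b` sending `x` to `f` and `y` to `g`. -/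
noncomputable def twoAgentsDesc {p m n : ℕ} (a : Fin p → Fin m) (b : Fin p → Fin n) {c : Base}
    (f : ob (.agent m) ⟶ c) (g : ob (.agent n) ⟶ c)
    (h : ∀ k, arr (.chan m (a k)) ≫ f = arr (.chan n (b k)) ≫ g) :
    twoAgents a b ⟶ rep c :=
  pushout.desc (yoneda.map f) (yoneda.map g) (by
    refine Sigma.hom_ext _ _ fun k => ?_
    simp only [pick, colimit.ι_desc_assoc, Cofan.mk_ι_app, ← Functor.map_comp, h, Discrete.functor])

/-- `[n] | [n] ⟶ πₙ`, given by `l ∘ s` and `r ∘ s`; the two agents share all channels in order. -/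
noncomputable def forkFinal (n : ℕ) :
    twoAgents (id : Fin n → Fin n) (id : Fin n → Fin n) ⟶ rep (ob (.fork n)) :=
  twoAgentsDesc _ _ (arr (.src (.forkL n)) ≫ arr (.left n)) (arr (.src (.forkR n)) ≫ arr (.right n))
    (by
      intro k
      have h1 := rel_src_tgt (.forkL n) k
      have h2 := rel_src_tgt (.forkR n) k
      have h3 := rel_fork n
      have e1 := congrArg (fun z => z ≫ arr (.left n)) h1
      have e2 := congrArg (fun z => z ≫ arr (.right n)) h2
      have e3 := congrArg (fun z => arr (.chan n k) ≫ z) h3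
      simp only [Category.assoc] at e1 e2 e3
      exact e1.trans (e3.trans e2.symm))

/-- `[m] _c|_a [n] ⟶ τ_{n,a,m,c,d}`, given by `ε ∘ t` and `ρ ∘ t`. -/
noncomputable def syncInitial (n : ℕ) (a : Fin n) (m : ℕ) (c d : Fin m) :
    twoAgents ![c] ![a] ⟶ rep (ob (.sync n a m c d)) :=
  twoAgentsDesc _ _ (arr (.tgt (.out m c d)) ≫ arr (.send n a m c d))
    (arr (.tgt (.inp n a)) ≫ arr (.recv n a m c d))
    (by
      intro k
      fin_cases k
      exact (rel_sync_subject n a m c d).symm)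

/-- `[m] _{c,d}|_{a,n+1} [n+1] ⟶ τ_{n,a,m,c,d}`, given by `ε ∘ s` and `ρ ∘ s`. -/
noncomputable def syncFinal (n : ℕ) (a : Fin n) (m : ℕ) (c d : Fin m) :
    twoAgents ![c, d] ![a.castSucc, Fin.last n] ⟶ rep (ob (.sync n a m c d)) :=
  twoAgentsDesc _ _ (arr (.src (.out m c d)) ≫ arr (.send n a m c d))
    (arr (.src (.inp n a)) ≫ arr (.recv n a m c d))
    (by
      intro k
      fin_cases k
      · have e1 := congrArg (fun z => z ≫ arr (.send n a m c d)) (rel_src_tgt (.out m c d) c)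
        have e2 := congrArg (fun z => z ≫ arr (.recv n a m c d)) (rel_src_tgt (.inp n a) a)
        simp only [Category.assoc] at e1 e2
        exact e1.trans ((rel_sync_subject n a m c d).symm.trans e2.symm)
      · exact (rel_sync_object n a m c d).symm)

/-- `IsSeed s t` says that the cospan `Y ⟶ c ⟵ X` with legs `s` and `t` is a seed;
`X` is its initial position and `Y` its final position. -/
inductive IsSeed : ∀ {Y X : Psh} {c : Base}, (Y ⟶ rep c) → (X ⟶ rep c) → Prop
  | act (v : Shape) : IsSeed (yoneda.map (arr (.src v))) (yoneda.map (arr (.tgt v)))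
  | fork (n : ℕ) :
      IsSeed (forkFinal n) (yoneda.map (arr (.tgt (.forkL n)) ≫ arr (.left n)))
  | sync (n : ℕ) (a : Fin n) (m : ℕ) (c d : Fin m) :
      IsSeed (syncFinal n a m c d) (syncInitial n a m c d)

/-! ## Actions and traces -/

/-- `IsAction s' t'` says that the cospan `Y' ⟶ M' ⟵ X'` is obtained from a seed `Y ⟶ c ⟵ X` by
pushing the cone from the interface `I_X` to the seed along a morphism of positions `I_X ⟶ Z`.
The leg `j : I_X ⟶ Y` of the cone is the factorisation of `I_X ⟶ X ⟶ c` through `Y`. -/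
def IsAction {Y' M' X' : Psh} (s' : Y' ⟶ M') (t' : X' ⟶ M') : Prop :=
  ∃ (Y X : Psh) (c : Base) (s : Y ⟶ rep c) (t : X ⟶ rep c) (j : interface X ⟶ Y)
    (Z : Psh) (h : interface X ⟶ Z)
    (y : Y ⟶ Y') (zy : Z ⟶ Y') (m : rep c ⟶ M') (zm : Z ⟶ M') (x : X ⟶ X') (zx : Z ⟶ X'),
    IsSeed s t ∧ j ≫ s = interfaceι X ≫ t ∧
    IsPosition Z ∧ OneInjective h ∧
    IsPushout j h y zy ∧
    IsPushout (interfaceι X ≫ t) h m zm ∧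
    IsPushout (interfaceι X) h x zx ∧
    y ≫ s' = s ≫ m ∧ zy ≫ s' = zm ∧
    x ≫ t' = t ≫ m ∧ zx ≫ t' = zm

/-- Finite, possibly empty, composites of actions between positions, in the bicategory of cospans:
composition is by pushout. The initial position is on the right. -/
inductive IsComposite : ∀ {Y U X : Psh}, (Y ⟶ U) → (X ⟶ U) → Prop
  | id (X : Psh) (hX : IsPosition X) : IsComposite (𝟙 X) (𝟙 X)
  | comp {Y U Z M X W : Psh} (s₂ : Y ⟶ U) (t₂ : Z ⟶ U) (s₁ : Z ⟶ M) (t₁ : X ⟶ M)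
      (i : U ⟶ W) (j : M ⟶ W) (h₂ : IsComposite s₂ t₂) (h₁ : IsAction s₁ t₁)
      (hW : IsPushout t₂ s₁ i j) : IsComposite (s₂ ≫ i) (t₁ ≫ j)

/-- A cospan is a trace if it is isomorphic, as a diagram, to a finite composite of actions. -/
def IsTrace {Y U X : Psh} (s : Y ⟶ U) (t : X ⟶ U) : Prop :=
  ∃ (Y' U' X' : Psh) (s' : Y' ⟶ U') (t' : X' ⟶ U') (eY : Y ≅ Y') (eU : U ≅ U') (eX : X ≅ X'),
    IsComposite s' t' ∧ s ≫ eU.hom = eY.hom ≫ s' ∧ t ≫ eU.hom = eX.hom ≫ t'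

/-! ## Cores and the causal graph -/

/-- A core is an element of dimension `> 1` which is not the image of any element of higher
dimension. -/
def IsCore (U : Psh) {c : Base} (μ : El U c) : Prop :=
  1 < dim c ∧ ∀ (d : Base) (f : c ⟶ d) (y : El U d), dim c < dim d → res U f y ≠ μ

/-- `x = μ · f · s` for some `f`. -/
def IsSource (U : Psh) {c : Base} (μ : El U c) (x : Agent U) : Prop :=
  ∃ (v : Shape) (f : ob (.act v) ⟶ c), x = ⟨v.finalArity, res U (arr (.src v)) (res U f μ)⟩

/-- `x = μ · f · t` for some `f`. -/
def IsTarget (U : Psh) {c : Base} (μ : El U c) (x : Agent U) : Prop :=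
  ∃ (v : Shape) (f : ob (.act v) ⟶ c), x = ⟨v.arity, res U (arr (.tgt v)) (res U f μ)⟩

/-- `Creates U μ a`: `μ` has shape `νₙ` or `ι_{n,i}`, and `a = μ · s · s_{n+1}`. -/
inductive Creates (U : Psh) : ∀ {c : Base}, El U c → Channel U → Prop
  | nu (n : ℕ) (μ : El U (ob (.act (.nu n)))) :
      Creates U μ (res U (arr (.chan (n + 1) (Fin.last n))) (res U (arr (.src (.nu n))) μ))
  | inp (n : ℕ) (i : Fin n) (μ : El U (ob (.act (.inp n i)))) :
      Creates U μ (res U (arr (.chan (n + 1) (Fin.last n))) (res U (arr (.src (.inp n i))) μ))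

/-- The vertices of the causal graph: channels, agents and cores. -/
inductive Vertex (U : Psh) : Type
  | channel (a : Channel U)
  | agent (x : Agent U)
  | core (c : Base) (μ : El U c) (hμ : IsCore U μ)

/-- The edges of the causal graph. -/
inductive CausalAdj (U : Psh) : Vertex U → Vertex U → Prop
  | agent_channel (n : ℕ) (x : El U (ob (.agent n))) (i : Fin n) :
      CausalAdj U (.agent ⟨n, x⟩) (.channel (res U (arr (.chan n i)) x))
  | source (c : Base) (μ : El U c) (hμ : IsCore U μ) (x : Agent U) (hx : IsSource U μ x) :
      CausalAdj U (.agent x) (.core c μ hμ)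
  | created (c : Base) (μ : El U c) (hμ : IsCore U μ) (a : Channel U) (ha : Creates U μ a) :
      CausalAdj U (.channel a) (.core c μ hμ)
  | target (c : Base) (μ : El U c) (hμ : IsCore U μ) (x : Agent U) (hx : IsTarget U μ x) :
      CausalAdj U (.core c μ hμ) (.agent x)

/-- The causal graph `G_U`. -/
def causalGraph (U : Psh) : Digraph (Vertex U) := ⟨CausalAdj U⟩

/-- The vertex is a core. -/
def Vertex.IsCoreVertex {U : Psh} : Vertex U → Prop
  | core _ _ _ => True
  | _ => False

/-- The vertex is an agent. -/
def Vertex.IsAgentVertex {U : Psh} : Vertex U → Prop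
  | agent _ => True
  | _ => False

/-- No agent or channel has edges to two distinct cores. -/
def SourceLinear {U : Psh} (G : Digraph (Vertex U)) : Prop :=
  ∀ μ μ' x : Vertex U, μ.IsCoreVertex → μ'.IsCoreVertex → G.Adj x μ → G.Adj x μ' → μ = μ'

/-- No agent has edges from two distinct cores. -/
def TargetLinear {U : Psh} (G : Digraph (Vertex U)) : Prop :=
  ∀ μ μ' x : Vertex U, μ.IsCoreVertex → μ'.IsCoreVertex → x.IsAgentVertex →
    G.Adj μ x → G.Adj μ' x → μ = μ'

/-- Linearity of the causal graph. -/
def Linear {U : Psh} (G : Digraph (Vertex U)) : Prop := SourceLinear G ∧ TargetLinear G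

/-- There is no directed cycle. -/
def Acyclic {V : Type} (G : Digraph V) : Prop := ∀ v : V, ¬ Relation.TransGen G.Adj v v

/-! ## Local 1-injectivity, initiality and finality -/

/-- For every seed `Y ⟶ c ⟵ X` with interface `I_X` and every core `μ` of `U` over `c`, if two
distinct elements of the representable presheaf on `c` are identified by the Yoneda morphism
corresponding to `μ`, then both are in the image of `I_X`. -/
def LocallyOneInjective (U : Psh) : Prop :=
  ∀ (Y X : Psh) (c : Base) (s : Y ⟶ rep c) (t : X ⟶ rep c), IsSeed s t →
    ∀ μ : El U c, IsCore U μ →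
      ∀ (d : Base) (x y : El (rep c) d), x ≠ y →
        (yonedaEquiv.symm μ).app (op d) x = (yonedaEquiv.symm μ).app (op d) y →
          x ∈ Set.range ((interfaceι X ≫ t).app (op d)) ∧
          y ∈ Set.range ((interfaceι X ≫ t).app (op d))

/-- The initial agents (those not of the form `μ · s`) and the initial channels (those not created
by any core) of `U`, as a set of elements of `U`. -/
inductive IsInitialEl (U : Psh) : ∀ {c : Base}, El U c → Prop
  | agent (n : ℕ) (x : El U (ob (.agent n)))
      (hx : ∀ (v : Shape) (μ : El U (ob (.act v))),
        (⟨n, x⟩ : Agent U) ≠ ⟨v.finalArity, res U (arr (.src v)) μ⟩) : IsInitialEl U x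
  | channel (a : Channel U)
      (ha : ∀ (c : Base) (μ : El U c), IsCore U μ → ¬ Creates U μ a) : IsInitialEl U a

/-- The final agents (those not of the form `μ · t`) and the final channels (all channels)
of `U`, as a set of elements of `U`. -/
inductive IsFinalEl (U : Psh) : ∀ {c : Base}, El U c → Prop
  | agent (n : ℕ) (x : El U (ob (.agent n)))
      (hx : ∀ (v : Shape) (μ : El U (ob (.act v))),
        (⟨n, x⟩ : Agent U) ≠ ⟨v.arity, res U (arr (.tgt v)) μ⟩) : IsFinalEl U x
  | channel (a : Channel U) : IsFinalEl U a

/-- The image of `t` consists exactly of the initial agents and channels of `U`. -/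
def ContainsExactlyInitial {X U : Psh} (t : X ⟶ U) : Prop :=
  ∀ (c : Base) (x : El U c), x ∈ Set.range (t.app (op c)) ↔ IsInitialEl U x

/-- The image of `s` consists exactly of the final agents and channels of `U`. -/
def ContainsExactlyFinal {Y U : Psh} (s : Y ⟶ U) : Prop :=
  ∀ (c : Base) (x : El U c), x ∈ Set.range (s.app (op c)) ↔ IsFinalEl U x

end PiTrace

/-!
A cospan `Y ⟶ U ⟵ X` is a trace if and only if it is *correct* (`IsCorrect`): the conditions of the
criterion hold, with acyclicity of the causal graph replaced by well-foundedness of its reversed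
edge relation, which is equivalent since `U` is finite. Both implications are inductions that add
or remove one action at the initial end of the cospan.

The core of the argument is the notion of a `Step`. A subpresheaf `A` of `W` is what remains of `W`
after the action of a core `μ` when the elements of `W` outside `A` are exactly those *spent* by
`μ`: the elements below `μ` of dimension at least two, and the targets of `μ`. A step moreover
relates the initial position `Z` of `A` to that of `W`: the latter contains the targets of `μ` and
the channels `μ` does not create, and `Z` consists of what the two positions share together with the
sources of `μ` and the channels it creates. For such data the cores of `W` are `μ` and those of `A`,
the causal graph of `A` is a full subgraph, and the edges of the causal graph leaving `A` all lead
to `μ`. Hence `A` is correct if and only if `W` is, up to local 1-injectivity at `μ`, which is part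
of the definition of a step (`Step.isCorrect_comp`, `Step.isCorrect_of_comp`).

* From traces to correct cospans: an action is described elementwise (`IsAction.exists_spec`),
  composing with it is a step (`ActionSpec.step`), and induction on composites concludes
  (`IsTrace.isCorrect`).
* From correct cospans to traces: if `W` has a core, well-foundedness yields a core `μ` from which
  no other core is reachable. Its targets and their channels are then initial, so `W` is the pushout of
  the remainder `A` and of the action made of `μ` and the initial position
  (`IsCorrect.exists_decomposition`). Linearity ensures that `A` is a subpresheaf. As `A` has fewer
  elements than `W`, induction applies (`IsCorrect.isTrace`). If there is no core, `W` is a position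
  and both legs are isomorphisms.

What is needed of the seeds is collected in `SeedSpec`. It is proved by computing the channels and
agents of the representable presheaves: two functors from the base category to types, defined on
the generating edges, separate the morphisms out of `⋆` and out of the `[n]`.
-/

namespace PiTrace

/-! ### Elements of presheaves and pushouts -/

/-- The action of a morphism of presheaves on an element. -/
def ap {U V : Psh} (φ : U ⟶ V) {d : Base} (x : El U d) : El V d := φ.app (op d) x

theorem ap_comp {U V W : Psh} (φ : U ⟶ V) (ψ : V ⟶ W) {d : Base} (x : El U d) :
    ap (φ ≫ ψ) x = ap ψ (ap φ x) := rfl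

theorem ap_id {U : Psh} {d : Base} (x : El U d) : ap (𝟙 U) x = x := rfl

theorem ap_congr {U V : Psh} {φ ψ : U ⟶ V} (h : φ = ψ) {d : Base} (x : El U d) :
    ap φ x = ap ψ x := by rw [h]

theorem hom_ext_ap {U V : Psh} {φ ψ : U ⟶ V} (h : ∀ (d : Base) (x : El U d), ap φ x = ap ψ x) :
    φ = ψ := by
  ext d x
  exact h d.unop x

theorem ap_res {U V : Psh} (φ : U ⟶ V) {c d : Base} (f : c ⟶ d) (x : El U d) :
    ap φ (res U f x) = res V f (ap φ x) :=
  NatTrans.naturality_apply φ f.op x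

theorem res_res (U : Psh) {b c d : Base} (f : b ⟶ c) (g : c ⟶ d) (x : El U d) :
    res U f (res U g x) = res U (f ≫ g) x := by
  simp [res]

theorem res_id (U : Psh) {c : Base} (x : El U c) : res U (𝟙 c) x = x := by
  simp [res]

theorem res_rep {c d e : Base} (f : d ⟶ e) (g : El (rep c) e) :
    res (rep c) f g = (f ≫ g : d ⟶ c) := rfl

/-- The Yoneda lemma: a map out of a representable is determined by the generic element. -/
theorem ap_eq_res {U : Psh} {c d : Base} (φ : rep c ⟶ U) (f : d ⟶ c) :
    ap φ (f : El (rep c) d) = res U f (ap φ (𝟙 c : El (rep c) c)) := by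
  rw [← ap_res, res_rep, Category.comp_id]

theorem mono_iff_ap {U V : Psh} (φ : U ⟶ V) :
    Mono φ ↔ ∀ (d : Base) (x y : El U d), ap φ x = ap φ y → x = y := by
  rw [NatTrans.mono_iff_mono_app]
  constructor
  · intro h d x y hxy
    exact (mono_iff_injective _).1 (h (op d)) hxy
  · intro h d
    exact (mono_iff_injective _).2 fun x y hxy => h d.unop x y hxy

theorem ap_injective {U V : Psh} (φ : U ⟶ V) [hφ : Mono φ] {d : Base} {x y : El U d}
    (h : ap φ x = ap φ y) : x = y :=
  (mono_iff_ap φ).1 hφ d x y h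

theorem isIso_of_ap {U V : Psh} (φ : U ⟶ V) [Mono φ]
    (h : ∀ (d : Base) (y : El V d), ∃ x, ap φ x = y) : IsIso φ := by
  rw [NatTrans.isIso_iff_isIso_app]
  intro d
  rw [isIso_iff_bijective]
  exact ⟨fun x y hxy => ap_injective φ (d := d.unop) hxy, h d.unop⟩

/-- A morphism whose values lie in the image of a monomorphism factors through it. -/
theorem exists_lift {U V W : Psh} (φ : U ⟶ W) (ψ : V ⟶ W) [Mono ψ]
    (h : ∀ (d : Base) (x : El U d), ∃ y : El V d, ap ψ y = ap φ x) : ∃ χ : U ⟶ V, χ ≫ ψ = φ := by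
  choose g hg using fun d => h d
  refine ⟨{ app := fun d => ↾(g d.unop), naturality := ?_ }, hom_ext_ap fun d x => hg d x⟩
  intro a b f
  ext x
  refine ap_injective ψ (d := b.unop) ?_
  have h1 := hg b.unop (res U f.unop x)
  have h2 := ap_res ψ f.unop (g a.unop x)
  rw [hg, ← ap_res] at h2
  exact h1.trans h2.symm

/-- A criterion for pushouts along a monomorphism `f`: `q` is injective, `p` is injective outside
the image of `f`, and the images of `p` and `q` cover `R` and meet only along `f`. -/
theorem isPushout_of_ap {I P Q R : Psh} {f : I ⟶ P} {g : I ⟶ Q} {p : P ⟶ R} {q : Q ⟶ R}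
    (w : f ≫ p = g ≫ q) [Mono f] [Mono q]
    (hp : ∀ (d : Base) (x y : El P d), ap p x = ap p y →
      (∀ i, ap f i ≠ x) → (∀ i, ap f i ≠ y) → x = y)
    (hpq : ∀ (d : Base) (x : El P d) (z : El Q d), ap p x = ap q z → ∃ i, ap f i = x)
    (hs : ∀ (d : Base) (r : El R d), (∃ x, ap p x = r) ∨ ∃ z, ap q z = r) :
    IsPushout f g p q := by
  refine IsPushout.flip (IsPushout.of_forall_isPushout_app fun d => ?_)
  have : Mono (q.app d) := (NatTrans.mono_iff_mono_app q).1 inferInstance d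
  refine Types.isPushout_of_isPullback_of_mono' ?_ ?_ ?_
  · rw [Types.isPullback_iff]
    refine ⟨by rw [← NatTrans.comp_app, ← NatTrans.comp_app, w], ?_, ?_⟩
    · rintro x y ⟨-, h⟩
      exact ap_injective f (d := d.unop) h
    · intro z x h
      obtain ⟨i, hi⟩ := hpq d.unop x z h.symm
      refine ⟨i, ?_, hi⟩
      refine ap_injective q (d := d.unop) ?_
      refine Eq.trans ?_ h.symm
      change ap (g ≫ q) i = ap p x
      rw [← w, ap_comp, hi]
  · ext r
    simp only [Set.sup_eq_union, Set.mem_union, Set.mem_range, Set.mem_univ, iff_true]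
    exact (hs d.unop r).symm
  · intro x y hx hy h
    exact hp d.unop x y h (fun i hi => hx ⟨i, hi⟩) (fun i hi => hy ⟨i, hi⟩)

section Pushout

variable {I P Q R : Psh} {f : I ⟶ P} {g : I ⟶ Q} {p : P ⟶ R} {q : Q ⟶ R}

theorem ap_comm_of_isPushout (h : IsPushout f g p q) {d : Base} (i : El I d) :
    ap p (ap f i) = ap q (ap g i) := ap_congr h.w i

theorem ap_cover_of_isPushout (h : IsPushout f g p q) {d : Base} (r : El R d) :
    (∃ x, ap p x = r) ∨ ∃ z, ap q z = r :=
  Types.eq_or_eq_of_isPushout (h.app (op d)) r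

theorem mono_inr_of_isPushout (h : IsPushout f g p q) [Mono f] : Mono q := by
  rw [mono_iff_ap]
  intro d x y
  have : Mono (f.app (op d)) := (NatTrans.mono_iff_mono_app f).1 inferInstance _
  exact fun hxy => Types.pushoutCocone_inr_injective_of_isColimit (h.app (op d)).isColimit
    ((mono_iff_injective _).1 this) hxy

theorem ap_eq_of_isPushout (h : IsPushout f g p q) [Mono f] {d : Base} {x : El P d} {z : El Q d}
    (e : ap p x = ap q z) : ∃ i, ap f i = x ∧ ap g i = z := by
  have : Mono (f.app (op d)) := (NatTrans.mono_iff_mono_app f).1 inferInstance _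
  exact (Types.pushoutCocone_inl_eq_inr_iff_of_isColimit (h.app (op d)).isColimit
    ((mono_iff_injective _).1 this) x z).1 e

/-- In a pushout along a monomorphism `f`, only elements in the image of `f` get identified. -/
theorem ap_inl_eq_of_isPushout (h : IsPushout f g p q) [Mono f] {d : Base} {x y : El P d}
    (e : ap p x = ap p y) : x = y ∨ ∃ i j, ap f i = x ∧ ap f j = y := by
  have hm : Mono (f.app (op d)) := (NatTrans.mono_iff_mono_app f).1 inferInstance _
  have hd := h.app (op d)
  have e' : (Types.Pushout.inl (f.app (op d)) (g.app (op d))) x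
      = (Types.Pushout.inl (f.app (op d)) (g.app (op d))) y := by
    obtain ⟨φ, hφ, -⟩ := hd.exists_desc _ _ (Types.Pushout.condition (f.app (op d)) (g.app (op d)))
    rw [← hφ]
    exact congrArg φ e
  have := (Types.Pushout.quot_mk_eq_iff _ _ (Sum.inl x) (Sum.inl y)).1 e'
  rw [Types.Pushout.inl_rel'_inl_iff] at this
  rcases this with h | ⟨i, j, -, hi, hj⟩
  · exact .inl h
  · exact .inr ⟨i, j, hi.symm, hj.symm⟩

end Pushout

/-! ### Morphisms of the base category -/

@[elab_as_elim]
theorem Base.rec_ob {P : Base → Prop} (h : ∀ x : Ob, P (ob x)) (c : Base) : P c := h c.as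

@[simp] theorem dim_star : dim (ob .star) = 0 := rfl
@[simp] theorem dim_agent (n : ℕ) : dim (ob (.agent n)) = 1 := rfl
@[simp] theorem dim_act (v : Shape) : dim (ob (.act v)) = 2 := rfl
@[simp] theorem dim_fork (n : ℕ) : dim (ob (.fork n)) = 3 := rfl
@[simp] theorem dim_sync (n : ℕ) (a : Fin n) (m : ℕ) (c d : Fin m) :
    dim (ob (.sync n a m c d)) = 4 := rfl

/-- Morphisms of the base category are generated by post-composition with edges. -/
theorem hom_induction {x : Ob} {P : ∀ {y : Ob}, (ob x ⟶ ob y) → Prop} (nil : P (𝟙 (ob x)))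
    (cons : ∀ {y z : Ob} (g : ob x ⟶ ob y) (e : Edge y z), P g → P (g ≫ arr e))
    {y : Ob} (f : ob x ⟶ ob y) : P f := by
  obtain ⟨p, rfl⟩ := (CategoryTheory.Quotient.functor Rel).map_surjective f
  change Quiver.Path x y at p
  induction p with
  | nil => exact nil
  | cons q e ih => exact cons _ e ih

theorem hom_cases {x y : Ob} (f : ob x ⟶ ob y) :
    (∃ h : x = y, f = eqToHom (by rw [h])) ∨
      ∃ (z : Ob) (g : ob x ⟶ ob z) (e : Edge z y), f = g ≫ arr e :=
  hom_induction (P := fun {y} f => (∃ h : x = y, f = eqToHom (by rw [h])) ∨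
      ∃ (z : Ob) (g : ob x ⟶ ob z) (e : Edge z y), f = g ≫ arr e)
    (.inl ⟨rfl, rfl⟩) (fun g e _ => .inr ⟨_, g, e, rfl⟩) f

/-- Non-identity morphisms strictly increase the dimension. -/
theorem eq_or_dim_lt {c d : Base} (f : c ⟶ d) : (∃ h : c = d, f = eqToHom h) ∨ dim c < dim d := by
  induction c using Base.rec_ob with | _ x
  induction d using Base.rec_ob with | _ y
  rcases hom_cases f with ⟨rfl, h⟩ | ⟨z, g, e, -⟩
  · exact .inl ⟨rfl, h⟩
  · exact .inr ((dim_le_of_hom g).trans_lt e.dim_lt)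

/-! ### Channels of the base objects -/

/-- The channels of a representable presheaf, in normal form. Those of `τ_{n,a,m,c,d}` are the `m`
channels of the sender and the `n + 1` final channels of the receiver; of the latter, the `a`-th and
the last one are identified with channels of the sender, so that their normal form is on the
left. -/
def Chan : Ob → Type
  | .star => Unit
  | .agent n => Fin n
  | .act v => Fin v.finalArity
  | .fork n => Fin n
  | .sync n _ m _ _ => Fin m ⊕ Fin (n + 1)

/-- The normal form in `τ_{n,a,m,c,d}` of the final channels of the receiver. -/
def recvChan {n m : ℕ} (a : Fin n) (c d : Fin m) (k : Fin (n + 1)) : Fin m ⊕ Fin (n + 1) :=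
  if k = a.castSucc then .inl c else if k = Fin.last n then .inl d else .inr k

theorem recvChan_castSucc {n m : ℕ} (a : Fin n) (c d : Fin m) :
    recvChan a c d a.castSucc = .inl c := if_pos rfl

theorem recvChan_last {n m : ℕ} (a : Fin n) (c d : Fin m) :
    recvChan a c d (Fin.last n) = .inl d :=
  (if_neg (Fin.castSucc_lt_last a).ne').trans (if_pos rfl)

/-- The effect of an edge on channels in normal form. -/
def chanMap : ∀ {x y : Ob}, Edge x y → Chan x → Chan y
  | _, _, .chan _ i, _ => i
  | _, _, .src _, k => k
  | _, _, .tgt v, k => Fin.castAdd v.fresh k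
  | _, _, .left _, k => k
  | _, _, .right _, k => k
  | _, _, .recv _ a _ c d, k => recvChan a c d k
  | _, _, .send _ _ _ _ _, k => .inl k

/-- The functor of channels. -/
def chanFunctor : Base ⥤ Type :=
  CategoryTheory.Quotient.lift Rel
    (Paths.lift { obj := Chan, map := fun e => ↾(chanMap e) }) (by
      rintro _ _ _ _ (⟨v, i⟩ | n | ⟨n, a, m, c, d⟩ | ⟨n, a, m, c, d⟩)
      · rfl
      · rfl
      · ext ⟨⟩
        exact recvChan_castSucc a c d
      · ext ⟨⟩
        exact recvChan_last a c d)

/-- The normal form of a channel of a representable presheaf. -/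
def chanIdx {y : Ob} (f : ob .star ⟶ ob y) : Chan y := chanFunctor.map f ()

theorem chanIdx_comp {y z : Ob} (g : ob .star ⟶ ob y) (e : Edge y z) :
    chanIdx (g ≫ arr e) = chanMap e (chanIdx g) := by
  unfold chanIdx
  rw [Functor.map_comp]
  rfl

/-- The channel with a given normal form. -/
def chanOf : ∀ {y : Ob}, Chan y → (ob .star ⟶ ob y)
  | .star, _ => 𝟙 _
  | .agent n, k => arr (.chan n k)
  | .act v, k => arr (.chan v.finalArity k) ≫ arr (.src v)
  | .fork n, k => arr (.chan n k) ≫ arr (.src (.forkL n)) ≫ arr (.left n)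
  | .sync n a m c d, .inl k => arr (.chan m k) ≫ arr (.src (.out m c d)) ≫ arr (.send n a m c d)
  | .sync n a m c d, .inr k =>
      arr (.chan (n + 1) k) ≫ arr (.src (.inp n a)) ≫ arr (.recv n a m c d)

theorem fork_chan (n : ℕ) (k : Fin n) :
    arr (.chan n k) ≫ arr (.src (.forkL n)) ≫ arr (.left n)
      = arr (.chan n k) ≫ arr (.src (.forkR n)) ≫ arr (.right n) := by
  have e1 := congrArg (fun z => z ≫ arr (.left n)) (rel_src_tgt (.forkL n) k)
  have e2 := congrArg (fun z => z ≫ arr (.right n)) (rel_src_tgt (.forkR n) k)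
  have e3 := congrArg (fun z => arr (.chan n k) ≫ z) (rel_fork n)
  simp only [Category.assoc] at e1 e2 e3
  exact e1.trans (e3.trans e2.symm)

theorem sync_subject_chan (n : ℕ) (a : Fin n) (m : ℕ) (c d : Fin m) :
    arr (.chan (n + 1) a.castSucc) ≫ arr (.src (.inp n a)) ≫ arr (.recv n a m c d)
      = arr (.chan m c) ≫ arr (.src (.out m c d)) ≫ arr (.send n a m c d) := by
  have e1 := congrArg (fun z => z ≫ arr (.send n a m c d)) (rel_src_tgt (.out m c d) c)
  have e2 := congrArg (fun z => z ≫ arr (.recv n a m c d)) (rel_src_tgt (.inp n a) a)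
  simp only [Category.assoc] at e1 e2
  exact e2.trans ((rel_sync_subject n a m c d).trans e1.symm)

theorem chanOf_map {y z : Ob} (e : Edge y z) (k : Chan y) :
    chanOf (chanMap e k) = chanOf k ≫ arr e := by
  cases e with
  | chan n i => exact (Category.id_comp _).symm
  | src v => rfl
  | tgt v => exact rel_src_tgt v k
  | left n => exact (Category.assoc _ _ _).symm
  | right n => exact (fork_chan n k).trans (Category.assoc _ _ _).symm
  | recv n a m c d =>
    change chanOf (y := .sync n a m c d) (recvChan a c d k) = _
    unfold recvChan
    split_ifs with h1 h2
    · subst h1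
      exact (sync_subject_chan n a m c d).symm.trans (Category.assoc _ _ _).symm
    · subst h2
      exact (rel_sync_object n a m c d).symm.trans (Category.assoc _ _ _).symm
    · exact (Category.assoc _ _ _).symm
  | send n a m c d => exact (Category.assoc _ _ _).symm

/-- Every channel is the one given by its normal form; in particular normal forms separate
channels. -/
theorem chanOf_chanIdx {y : Ob} (f : ob .star ⟶ ob y) : chanOf (chanIdx f) = f := by
  refine hom_induction (P := fun {y} f => chanOf (chanIdx f) = f) rfl (fun g e h => ?_) f
  rw [chanIdx_comp, chanOf_map, h]

theorem chanIdx_injective {y : Ob} {f g : ob .star ⟶ ob y} (h : chanIdx f = chanIdx g) : f = g := by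
  rw [← chanOf_chanIdx f, h, chanOf_chanIdx]

theorem exists_eq_chan {n : ℕ} (f : ob .star ⟶ ob (.agent n)) :
    ∃ i, f = arr (.chan n i) :=
  ⟨chanIdx f, (chanOf_chanIdx f).symm⟩

/-! ### Agents of the base objects -/

/-- Labels separating the agents of a representable presheaf: whether the agent comes before or
after the action, and on which side (the agent before a fork lies on both). -/
def AgentLabel : Ob → Type
  | .star => Empty
  | .agent _ => Unit
  | .act _ => Bool
  | .fork _ => Bool × Bool
  | .sync _ _ _ _ _ => Bool × Bool

/-- The effect of an edge on labels. -/
def labelMap : ∀ {x y : Ob}, Edge x y → AgentLabel x → AgentLabel y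
  | _, _, .chan _ _, k => k.elim
  | _, _, .src _, _ => true
  | _, _, .tgt _, _ => false
  | _, _, .left _, k => (k, k)
  | _, _, .right _, k => (k, false)
  | _, _, .recv _ _ _ _ _, k => (k, true)
  | _, _, .send _ _ _ _ _, k => (k, false)

/-- The functor of labels of agents. -/
def labelFunctor : Base ⥤ Type :=
  CategoryTheory.Quotient.lift Rel
    (Paths.lift { obj := AgentLabel, map := fun e => ↾(labelMap e) }) (by
      rintro _ _ _ _ (⟨v, i⟩ | n | ⟨n, a, m, c, d⟩ | ⟨n, a, m, c, d⟩)
      · ext ⟨⟩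
      · rfl
      · ext ⟨⟩
      · ext ⟨⟩)

/-- The label of an agent of a representable presheaf. -/
def label {n : ℕ} {y : Ob} (f : ob (.agent n) ⟶ ob y) : AgentLabel y := labelFunctor.map f ()

theorem label_comp {n : ℕ} {y z : Ob} (g : ob (.agent n) ⟶ ob y) (e : Edge y z) :
    label (g ≫ arr e) = labelMap e (label g) := by
  unfold label
  rw [Functor.map_comp]
  rfl

theorem label_src (v : Shape) : label (arr (.src v)) = true := rfl

theorem agent_hom_agent {k n : ℕ} (f : ob (.agent k) ⟶ ob (.agent n)) :
    ∃ h : k = n, f = eqToHom (by rw [h]) := by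
  rcases hom_cases f with ⟨h, hf⟩ | ⟨z, g, e, -⟩
  · cases h
    exact ⟨rfl, hf⟩
  · cases e
    exact absurd (dim_le_of_hom g) (by simp)

theorem hom_agent_subsingleton {k n : ℕ} (f g : ob (.agent k) ⟶ ob (.agent n)) : f = g := by
  obtain ⟨rfl, rfl⟩ := agent_hom_agent f
  obtain ⟨-, rfl⟩ := agent_hom_agent g
  rfl

theorem act_hom_act {v w : Shape} (f : ob (.act v) ⟶ ob (.act w)) :
    ∃ h : v = w, f = eqToHom (by rw [h]) := by
  rcases hom_cases f with ⟨h, hf⟩ | ⟨z, g, e, -⟩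
  · cases h
    exact ⟨rfl, hf⟩
  · cases e <;> exact absurd (dim_le_of_hom g) (by simp)

theorem act_hom_fork {v : Shape} {n : ℕ} (f : ob (.act v) ⟶ ob (.fork n)) :
    (∃ h : v = .forkL n, f = eqToHom (by rw [h]) ≫ arr (.left n)) ∨
      ∃ h : v = .forkR n, f = eqToHom (by rw [h]) ≫ arr (.right n) := by
  rcases hom_cases f with ⟨h, -⟩ | ⟨z, g, e, rfl⟩
  · cases h
  · cases e with
    | left =>
      obtain ⟨rfl, rfl⟩ := act_hom_act g
      exact .inl ⟨rfl, rfl⟩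
    | right =>
      obtain ⟨rfl, rfl⟩ := act_hom_act g
      exact .inr ⟨rfl, rfl⟩

theorem act_hom_sync {v : Shape} {n : ℕ} {a : Fin n} {m : ℕ} {c d : Fin m}
    (f : ob (.act v) ⟶ ob (.sync n a m c d)) :
    (∃ h : v = .inp n a, f = eqToHom (by rw [h]) ≫ arr (.recv n a m c d)) ∨
      ∃ h : v = .out m c d, f = eqToHom (by rw [h]) ≫ arr (.send n a m c d) := by
  rcases hom_cases f with ⟨h, -⟩ | ⟨z, g, e, rfl⟩
  · cases h
  · cases e with
    | recv =>
      obtain ⟨rfl, rfl⟩ := act_hom_act g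
      exact .inl ⟨rfl, rfl⟩
    | send =>
      obtain ⟨rfl, rfl⟩ := act_hom_act g
      exact .inr ⟨rfl, rfl⟩

/-- Every agent of a representable presheaf of dimension at least two lies before or after an
action. -/
theorem agent_hom_cases {k : ℕ} {c : Base} (f : ob (.agent k) ⟶ c) (hc : 1 < dim c) :
    ∃ (v : Shape) (g : ob (.act v) ⟶ c),
      (∃ h : k = v.finalArity, f = eqToHom (by rw [h]) ≫ arr (.src v) ≫ g) ∨
      (∃ h : k = v.arity, f = eqToHom (by rw [h]) ≫ arr (.tgt v) ≫ g) := by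
  induction c using Base.rec_ob with | _ y
  revert hc
  refine hom_induction (P := fun {y} f => 1 < dim (ob y) → ∃ (v : Shape) (g : ob (.act v) ⟶ ob y),
      (∃ h : k = v.finalArity, f = eqToHom (by rw [h]) ≫ arr (.src v) ≫ g) ∨
      (∃ h : k = v.arity, f = eqToHom (by rw [h]) ≫ arr (.tgt v) ≫ g)) ?_ ?_ f
  · intro h
    exact absurd h (by simp)
  · intro y z g e ih hz
    by_cases hy : 1 < dim (ob y)
    · obtain ⟨v, g', ⟨h, rfl⟩ | ⟨h, rfl⟩⟩ := ih hy
      · exact ⟨v, g' ≫ arr e, .inl ⟨h, by simp⟩⟩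
      · exact ⟨v, g' ≫ arr e, .inr ⟨h, by simp⟩⟩
    · cases e with
      | chan => exact absurd hz (by simp)
      | src v =>
        obtain ⟨rfl, rfl⟩ := agent_hom_agent g
        exact ⟨v, 𝟙 _, .inl ⟨rfl, by simp⟩⟩
      | tgt v =>
        obtain ⟨rfl, rfl⟩ := agent_hom_agent g
        exact ⟨v, 𝟙 _, .inr ⟨rfl, by simp⟩⟩
      | left => exact absurd hy (by simp)
      | right => exact absurd hy (by simp)
      | recv => exact absurd hy (by simp)
      | send => exact absurd hy (by simp)

theorem exists_act_hom {c : Base} (hc : 1 < dim c) :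
    ∃ v : Shape, Nonempty (ob (.act v) ⟶ c) := by
  induction c using Base.rec_ob with | _ y
  cases y with
  | star => exact absurd hc (by simp)
  | agent => exact absurd hc (by simp)
  | act v => exact ⟨v, ⟨𝟙 _⟩⟩
  | fork n => exact ⟨_, ⟨arr (.left n)⟩⟩
  | sync n a m c d => exact ⟨_, ⟨arr (.send n a m c d)⟩⟩

theorem dim_le_four (c : Base) : dim c ≤ 4 := by
  induction c using Base.rec_ob with | _ y
  cases y <;> simp

/-- The objects of dimension at most one are `⋆` and the `[n]`. -/
theorem eq_of_dim_le_one {c : Base} (hc : dim c ≤ 1) :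
    c = ob .star ∨ ∃ n, c = ob (.agent n) := by
  induction c using Base.rec_ob with | _ y
  cases y with
  | star => exact .inl rfl
  | agent n => exact .inr ⟨n, rfl⟩
  | _ => exact absurd hc (by simp)

/-! ### Sources, targets and created channels of a generic element -/

/-- The normal form of a channel of a representable presheaf is one learnt by the agent performing
the action. -/
def Fresh : ∀ {y : Ob}, Chan y → Prop
  | .act v, (k : Fin v.finalArity) => v.arity ≤ k.val
  | .star, _ => False
  | .agent _, _ => False
  | .fork _, _ => False
  | .sync _ _ _ _ _, _ => False

/-- The channel `f` of the representable presheaf on `c` is created by the generic element. -/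
def IsFresh {c : Base} (f : ob .star ⟶ c) : Prop := Fresh (chanIdx (y := c.as) f)

theorem creates_iff {U : Psh} {c : Base} (μ : El U c) (a : Channel U) :
    Creates U μ a ↔ ∃ f : ob .star ⟶ c, IsFresh f ∧ a = res U f μ := by
  constructor
  · rintro (⟨n, μ⟩ | ⟨n, i, μ⟩)
    · exact ⟨arr (.chan (n + 1) (Fin.last n)) ≫ arr (.src (.nu n)), le_refl n, res_res U _ _ _⟩
    · exact ⟨arr (.chan (n + 1) (Fin.last n)) ≫ arr (.src (.inp n i)), le_refl n, res_res U _ _ _⟩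
  · rintro ⟨f, hf, rfl⟩
    induction c using Base.rec_ob with | _ y
    rw [← chanOf_chanIdx f]
    change Fresh (chanIdx f) at hf
    generalize chanIdx f = k at hf
    cases y with
    | act v =>
      change Fin v.finalArity at k
      change v.arity ≤ k.val at hf
      have hk := k.isLt
      cases v with
      | nu n =>
        obtain rfl : k = Fin.last n := Fin.ext (le_antisymm (Nat.lt_succ_iff.1 hk) hf)
        have := Creates.nu n μ
        rwa [res_res] at this
      | inp n i =>
        obtain rfl : k = Fin.last n := Fin.ext (le_antisymm (Nat.lt_succ_iff.1 hk) hf)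
        have := Creates.inp n i μ
        rwa [res_res] at this
      | _ => exact absurd hk (not_lt.2 hf)
    | _ => exact hf.elim

theorem isSource_iff {U : Psh} {c : Base} (μ : El U c) (x : Agent U) :
    IsSource U μ x ↔
      ∃ (v : Shape) (f : ob (.act v) ⟶ c), x = ⟨v.finalArity, res U (arr (.src v) ≫ f) μ⟩ := by
  simp only [IsSource, res_res]

theorem isTarget_iff {U : Psh} {c : Base} (μ : El U c) (x : Agent U) :
    IsTarget U μ x ↔
      ∃ (v : Shape) (f : ob (.act v) ⟶ c), x = ⟨v.arity, res U (arr (.tgt v) ≫ f) μ⟩ := by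
  simp only [IsTarget, res_res]

/-- An agent of the representable presheaf on `c` lying after an action. -/
def IsSrc {k : ℕ} {c : Base} (f : ob (.agent k) ⟶ c) : Prop :=
  ∃ (v : Shape) (h : k = v.finalArity) (g : ob (.act v) ⟶ c),
    f = eqToHom (by rw [h]) ≫ arr (.src v) ≫ g

/-- An agent of the representable presheaf on `c` lying before an action. -/
def IsTgt {k : ℕ} {c : Base} (f : ob (.agent k) ⟶ c) : Prop :=
  ∃ (v : Shape) (h : k = v.arity) (g : ob (.act v) ⟶ c),
    f = eqToHom (by rw [h]) ≫ arr (.tgt v) ≫ g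

theorem isSrc_of {v : Shape} {c : Base} (g : ob (.act v) ⟶ c) : IsSrc (arr (.src v) ≫ g) :=
  ⟨v, rfl, g, (Category.id_comp _).symm⟩

theorem isTgt_of {v : Shape} {c : Base} (g : ob (.act v) ⟶ c) : IsTgt (arr (.tgt v) ≫ g) :=
  ⟨v, rfl, g, (Category.id_comp _).symm⟩

theorem isSource_iff_exists_isSrc {U : Psh} {c : Base} (μ : El U c) (k : ℕ)
    (x : El U (ob (.agent k))) :
    IsSource U μ ⟨k, x⟩ ↔ ∃ f : ob (.agent k) ⟶ c, IsSrc f ∧ x = res U f μ := by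
  rw [isSource_iff]
  constructor
  · rintro ⟨v, f, h⟩
    cases h
    exact ⟨_, isSrc_of f, rfl⟩
  · rintro ⟨_, ⟨v, rfl, g, rfl⟩, rfl⟩
    exact ⟨v, g, by simp⟩

theorem isTarget_iff_exists_isTgt {U : Psh} {c : Base} (μ : El U c) (k : ℕ)
    (x : El U (ob (.agent k))) :
    IsTarget U μ ⟨k, x⟩ ↔ ∃ f : ob (.agent k) ⟶ c, IsTgt f ∧ x = res U f μ := by
  rw [isTarget_iff]
  constructor
  · rintro ⟨v, f, h⟩
    cases h
    exact ⟨_, isTgt_of f, rfl⟩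
  · rintro ⟨_, ⟨v, rfl, g, rfl⟩, rfl⟩
    exact ⟨v, g, by simp⟩

theorem isSrc_or_isTgt {k : ℕ} {c : Base} (hc : 1 < dim c) (f : ob (.agent k) ⟶ c) :
    IsSrc f ∨ IsTgt f := by
  obtain ⟨v, g, ⟨h, e⟩ | ⟨h, e⟩⟩ := agent_hom_cases f hc
  · exact .inl ⟨v, h, g, e⟩
  · exact .inr ⟨v, h, g, e⟩

/-- Whether a label is that of an agent after the action. -/
def polarity : ∀ {y : Ob}, AgentLabel y → Bool
  | .star, _ => false
  | .agent _, _ => false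
  | .act _, b => b
  | .fork _, p => p.1
  | .sync _ _ _ _ _, p => p.1

/-- Whether an agent comes before or after the action is invariant under further composition. -/
theorem polarity_comp {k : ℕ} {v : Shape} {y : Ob} (f : ob (.agent k) ⟶ ob (.act v))
    (g : ob (.act v) ⟶ ob y) : polarity (label (f ≫ g)) = label f := by
  refine hom_induction (P := fun {y} g => polarity (label (f ≫ g)) = label f) ?_ ?_ g
  · rw [Category.comp_id]
    rfl
  · intro y z g e ih
    rw [← ih, ← Category.assoc, label_comp]
    cases e with
    | chan => exact absurd (dim_le_of_hom g) (by simp)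
    | src => exact absurd (dim_le_of_hom g) (by simp)
    | tgt => exact absurd (dim_le_of_hom g) (by simp)
    | _ => rfl

theorem not_isTgt_of_isSrc {k : ℕ} {c : Base} {f : ob (.agent k) ⟶ c} (hs : IsSrc f) :
    ¬ IsTgt f := by
  induction c using Base.rec_ob with | _ y
  obtain ⟨v, rfl, g, rfl⟩ := hs
  rintro ⟨w, h, g', e⟩
  have e1 := polarity_comp (arr (.src v)) g
  have e2 := polarity_comp (eqToHom (congrArg (fun n => ob (.agent n)) h) ≫ arr (.tgt w)) g'
  rw [Category.assoc, ← e, eqToHom_refl, Category.id_comp, e1, label_src, label_comp] at e2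
  exact Bool.noConfusion e2

/-! ### Properties of the seeds -/

/-- The properties of the seeds on which the correctness criterion rests: the final position
consists of all channels and of the agents after the action, the initial one of the channels that
are not created and of the agents before the action, and each of its channels belongs to one of its
agents. -/
structure SeedSpec {Y X : Psh} {c : Base} (s : Y ⟶ rep c) (t : X ⟶ rep c) : Prop where
  one_lt_dim : 1 < dim c
  mono_s : Mono s
  mono_t : Mono t
  dim_s : ∀ {d : Base}, El Y d → dim d ≤ 1
  dim_t : ∀ {d : Base}, El X d → dim d ≤ 1
  star_s : ∀ f : ob .star ⟶ c, ∃ u : El Y (ob .star), ap s u = f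
  star_t : ∀ f : ob .star ⟶ c, (∃ u : El X (ob .star), ap t u = f) ↔ ¬ IsFresh f
  agent_s : ∀ {k : ℕ} (f : ob (.agent k) ⟶ c),
    (∃ u : El Y (ob (.agent k)), ap s u = f) ↔ IsSrc f
  agent_t : ∀ {k : ℕ} (f : ob (.agent k) ⟶ c),
    (∃ u : El X (ob (.agent k)), ap t u = f) ↔ IsTgt f
  star_agent : ∀ u : El X (ob .star), ∃ (n : ℕ) (j : Fin n) (v : El X (ob (.agent n))),
    u = res X (arr (.chan n j)) v

theorem exists_agent_of_rep {n : ℕ} (u : El (rep (ob (.agent n))) (ob .star)) :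
    ∃ (k : ℕ) (j : Fin k) (v : El (rep (ob (.agent n))) (ob (.agent k))),
      u = res _ (arr (.chan k j)) v := by
  obtain ⟨j, rfl⟩ := exists_eq_chan u
  exact ⟨n, j, 𝟙 (ob (.agent n)), (Category.comp_id _).symm⟩

theorem dim_le_of_agent {d : Base} {n : ℕ} (u : El (rep (ob (.agent n))) d) : dim d ≤ 1 :=
  dim_le_of_hom (show d ⟶ ob (.agent n) from u)

theorem chanIdx_chan_comp_edge {n : ℕ} {z : Ob} (i : Fin n) (e : Edge (.agent n) z) :
    chanIdx (arr (.chan n i) ≫ arr e) = chanMap e i := chanIdx_comp _ _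

theorem chanIdx_chan_comp_edge₂ {n : ℕ} {y z : Ob} (i : Fin n) (e : Edge (.agent n) y)
    (e' : Edge y z) :
    chanIdx (arr (.chan n i) ≫ arr e ≫ arr e') = chanMap e' (chanMap e i) := by
  rw [← Category.assoc, chanIdx_comp, chanIdx_comp]
  rfl

/-- A map out of a representable agent is injective as soon as it is so on channels. -/
theorem cancel_of_chan {n : ℕ} {c : Base} (f : ob (.agent n) ⟶ c)
    (hf : ∀ i j : Fin n, arr (.chan n i) ≫ f = arr (.chan n j) ≫ f → i = j)
    {d : Base} (u u' : d ⟶ ob (.agent n)) (h : u ≫ f = u' ≫ f) : u = u' := by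
  obtain rfl | ⟨k, rfl⟩ := eq_of_dim_le_one (dim_le_of_agent (n := n) u)
  · obtain ⟨i, rfl⟩ := exists_eq_chan u
    obtain ⟨j, rfl⟩ := exists_eq_chan u'
    rw [hf _ _ h]
  · exact hom_agent_subsingleton u u'

theorem mono_yoneda_of_chan {n : ℕ} {c : Base} (f : ob (.agent n) ⟶ c)
    (hf : ∀ i j : Fin n, arr (.chan n i) ≫ f = arr (.chan n j) ≫ f → i = j) :
    Mono (yoneda.map f) := by
  rw [mono_iff_ap]
  intro d u u' h
  exact cancel_of_chan f hf u u' h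

theorem seedSpec_act (v : Shape) :
    SeedSpec (yoneda.map (arr (.src v))) (yoneda.map (arr (.tgt v))) where
  one_lt_dim := by simp
  mono_s := mono_yoneda_of_chan _ fun i j h => by
    have := congrArg chanIdx h
    rwa [chanIdx_chan_comp_edge, chanIdx_chan_comp_edge] at this
  mono_t := mono_yoneda_of_chan _ fun i j h => by
    have := congrArg chanIdx h
    rw [chanIdx_chan_comp_edge, chanIdx_chan_comp_edge] at this
    exact Fin.castAdd_injective _ _ this
  dim_s u := dim_le_of_agent u
  dim_t u := dim_le_of_agent u
  star_s f := ⟨arr (.chan _ (chanIdx f)), chanOf_chanIdx f⟩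
  star_t f := by
    constructor
    · rintro ⟨u, rfl⟩ h
      obtain ⟨i, rfl⟩ := exists_eq_chan u
      change Fresh (chanIdx (arr (.chan _ i) ≫ arr (.tgt v))) at h
      rw [chanIdx_chan_comp_edge] at h
      exact absurd h (not_le.2 i.isLt)
    · intro h
      have h' : (show Fin v.finalArity from chanIdx f).val < v.arity := not_le.1 h
      refine ⟨arr (.chan _ ⟨_, h'⟩), chanIdx_injective ?_⟩
      exact chanIdx_chan_comp_edge _ _
  star_agent := exists_agent_of_rep
  agent_s f := by
    constructor
    · rintro ⟨u, rfl⟩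
      obtain ⟨h, rfl⟩ := agent_hom_agent u
      exact ⟨v, h, 𝟙 _, by rw [Category.comp_id]; rfl⟩
    · rintro ⟨w, h, g, rfl⟩
      obtain ⟨rfl, rfl⟩ := act_hom_act g
      exact ⟨eqToHom (by rw [h]), by simp; rfl⟩
  agent_t f := by
    constructor
    · rintro ⟨u, rfl⟩
      obtain ⟨h, rfl⟩ := agent_hom_agent u
      exact ⟨v, h, 𝟙 _, by rw [Category.comp_id]; rfl⟩
    · rintro ⟨w, h, g, rfl⟩
      obtain ⟨rfl, rfl⟩ := act_hom_act g
      exact ⟨eqToHom (by rw [h]), by simp; rfl⟩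

section TwoAgents

variable {p m n : ℕ} {a : Fin p → Fin m} {b : Fin p → Fin n}

theorem twoAgents_cases {d : Base} (u : El (twoAgents a b) d) :
    (∃ x : d ⟶ ob (.agent m), ap (pushout.inl (pick a) (pick b)) x = u) ∨
      ∃ x : d ⟶ ob (.agent n), ap (pushout.inr (pick a) (pick b)) x = u :=
  ap_cover_of_isPushout (IsPushout.of_hasPushout (pick a) (pick b)) u

theorem twoAgents_glue (k : Fin p) :
    ap (pushout.inl (pick a) (pick b)) (d := ob .star) (arr (.chan m (a k)))
      = ap (pushout.inr (pick a) (pick b)) (d := ob .star) (arr (.chan n (b k))) := by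
  have h := congrArg (fun z => Sigma.ι (fun _ : Fin p => rep (ob .star)) k ≫ z)
    (pushout.condition (f := pick a) (g := pick b))
  have ha : Sigma.ι (fun _ : Fin p => rep (ob .star)) k ≫ pick a
      = yoneda.map (arr (.chan m (a k))) := by simp [pick]
  have hb : Sigma.ι (fun _ : Fin p => rep (ob .star)) k ≫ pick b
      = yoneda.map (arr (.chan n (b k))) := by simp [pick]
  simp only [← Category.assoc, ha, hb] at h
  have := ap_congr h (d := ob .star) (𝟙 _)
  rw [ap_comp, ap_comp] at this
  change ap (pushout.inl (pick a) (pick b)) (d := ob .star) (𝟙 (ob .star) ≫ arr (.chan m (a k)))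
    = ap (pushout.inr (pick a) (pick b)) (d := ob .star) (𝟙 (ob .star) ≫ arr (.chan n (b k)))
    at this
  rwa [Category.id_comp, Category.id_comp] at this

theorem dim_le_of_twoAgents {d : Base} (u : El (twoAgents a b) d) : dim d ≤ 1 := by
  obtain ⟨x, -⟩ | ⟨x, -⟩ := twoAgents_cases u
  · exact dim_le_of_agent x
  · exact dim_le_of_agent x

theorem exists_agent_of_twoAgents (u : El (twoAgents a b) (ob .star)) :
    ∃ (k : ℕ) (j : Fin k) (v : El (twoAgents a b) (ob (.agent k))),
      u = res _ (arr (.chan k j)) v := by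
  obtain ⟨x, rfl⟩ | ⟨x, rfl⟩ := twoAgents_cases u <;>
  · obtain ⟨k, j, v, rfl⟩ := exists_agent_of_rep x
    exact ⟨k, j, _, ap_res _ _ v⟩

variable {c : Base} {f : ob (.agent m) ⟶ c} {g : ob (.agent n) ⟶ c}
  {h : ∀ k, arr (.chan m (a k)) ≫ f = arr (.chan n (b k)) ≫ g}

theorem twoAgentsDesc_inl {d : Base} (x : d ⟶ ob (.agent m)) :
    ap (twoAgentsDesc a b f g h) (ap (pushout.inl (pick a) (pick b)) x) = (x ≫ f : d ⟶ c) := by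
  rw [← ap_comp, twoAgentsDesc, pushout.inl_desc]
  rfl

theorem twoAgentsDesc_inr {d : Base} (x : d ⟶ ob (.agent n)) :
    ap (twoAgentsDesc a b f g h) (ap (pushout.inr (pick a) (pick b)) x) = (x ≫ g : d ⟶ c) := by
  rw [← ap_comp, twoAgentsDesc, pushout.inr_desc]
  rfl

theorem exists_twoAgentsDesc_iff {d : Base} (x : d ⟶ c) :
    (∃ u, ap (twoAgentsDesc a b f g h) u = x) ↔
      (∃ y : d ⟶ ob (.agent m), y ≫ f = x) ∨ ∃ y : d ⟶ ob (.agent n), y ≫ g = x := by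
  constructor
  · rintro ⟨u, hu⟩
    obtain ⟨y, rfl⟩ | ⟨y, rfl⟩ := twoAgents_cases u
    · exact .inl ⟨y, by rw [← hu, twoAgentsDesc_inl]⟩
    · exact .inr ⟨y, by rw [← hu, twoAgentsDesc_inr]⟩
  · rintro (⟨y, rfl⟩ | ⟨y, rfl⟩)
    · exact ⟨_, twoAgentsDesc_inl y⟩
    · exact ⟨_, twoAgentsDesc_inr y⟩

/-- The map out of two agents is injective if it separates the agents and identifies no more
channels than are already shared. -/
theorem mono_twoAgentsDesc
    (hf : ∀ i j, arr (.chan m i) ≫ f = arr (.chan m j) ≫ f → i = j)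
    (hg : ∀ i j, arr (.chan n i) ≫ g = arr (.chan n j) ≫ g →
      i = j ∨ ∃ k l, i = b k ∧ j = b l ∧ a k = a l)
    (hfg : ∀ i j, arr (.chan m i) ≫ f = arr (.chan n j) ≫ g → ∃ k, i = a k ∧ j = b k)
    (hne : ∀ (k : ℕ) (x : ob (.agent k) ⟶ ob (.agent m)) (y : ob (.agent k) ⟶ ob (.agent n)),
      x ≫ f ≠ y ≫ g) :
    Mono (twoAgentsDesc a b f g h) := by
  have hmix : ∀ {d : Base} (x : d ⟶ ob (.agent m)) (y : d ⟶ ob (.agent n)), x ≫ f = y ≫ g →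
      ap (pushout.inl (pick a) (pick b)) x = ap (pushout.inr (pick a) (pick b)) y := by
    intro d x y e
    obtain rfl | ⟨k, rfl⟩ := eq_of_dim_le_one (dim_le_of_agent (n := m) x)
    · obtain ⟨i, rfl⟩ := exists_eq_chan x
      obtain ⟨j, rfl⟩ := exists_eq_chan y
      obtain ⟨k, h1, h2⟩ := hfg _ _ e
      rw [h1, h2]
      exact twoAgents_glue k
    · exact absurd e (hne k x y)
  rw [mono_iff_ap]
  intro d u u' e
  obtain ⟨x, rfl⟩ | ⟨x, rfl⟩ := twoAgents_cases u <;>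
  obtain ⟨y, rfl⟩ | ⟨y, rfl⟩ := twoAgents_cases u'
  · rw [twoAgentsDesc_inl, twoAgentsDesc_inl] at e
    rw [cancel_of_chan f hf x y e]
  · rw [twoAgentsDesc_inl, twoAgentsDesc_inr] at e
    exact hmix x y e
  · rw [twoAgentsDesc_inl, twoAgentsDesc_inr] at e
    exact (hmix y x e.symm).symm
  · rw [twoAgentsDesc_inr, twoAgentsDesc_inr] at e
    obtain rfl | ⟨k, rfl⟩ := eq_of_dim_le_one (dim_le_of_agent (n := n) x)
    · obtain ⟨i, rfl⟩ := exists_eq_chan x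
      obtain ⟨j, rfl⟩ := exists_eq_chan y
      obtain h | ⟨k, l, h1, h2, h3⟩ := hg _ _ e
      · rw [h]
      · rw [h1, h2, ← twoAgents_glue, ← twoAgents_glue, h3]
    · rw [hom_agent_subsingleton x y]

end TwoAgents

theorem seedSpec_fork (n : ℕ) :
    SeedSpec (forkFinal n) (yoneda.map (arr (.tgt (.forkL n)) ≫ arr (.left n))) where
  one_lt_dim := by simp
  mono_s := by
    refine mono_twoAgentsDesc (fun i j h => ?_) (fun i j h => .inl ?_) (fun i j h => ⟨i, rfl, ?_⟩)
      (fun k x y h => ?_)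
    · have := congrArg chanIdx h
      rwa [chanIdx_chan_comp_edge₂, chanIdx_chan_comp_edge₂] at this
    · have := congrArg chanIdx h
      rwa [chanIdx_chan_comp_edge₂, chanIdx_chan_comp_edge₂] at this
    · have := congrArg chanIdx h
      rw [chanIdx_chan_comp_edge₂, chanIdx_chan_comp_edge₂] at this
      exact this.symm
    · have := congrArg label h
      rw [← Category.assoc, ← Category.assoc, label_comp, label_comp, label_comp,
        label_comp] at this
      exact absurd (congrArg Prod.snd this) Bool.noConfusion
  mono_t := mono_yoneda_of_chan _ fun i j h => by
    have := congrArg chanIdx h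
    rwa [chanIdx_chan_comp_edge₂, chanIdx_chan_comp_edge₂] at this
  dim_s u := dim_le_of_twoAgents u
  dim_t u := dim_le_of_agent u
  star_s f := by
    rw [forkFinal, exists_twoAgentsDesc_iff]
    exact .inl ⟨_, chanOf_chanIdx f⟩
  star_t f := by
    refine ⟨fun _ h => h, fun _ => ⟨arr (.chan n (chanIdx f)), chanIdx_injective ?_⟩⟩
    exact chanIdx_chan_comp_edge₂ _ _ _
  star_agent := exists_agent_of_rep
  agent_s {k} f := by
    rw [forkFinal, exists_twoAgentsDesc_iff]
    constructor
    · rintro (⟨u, rfl⟩ | ⟨u, rfl⟩)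
      · obtain ⟨h, rfl⟩ := agent_hom_agent u
        exact ⟨.forkL n, h, _, rfl⟩
      · obtain ⟨h, rfl⟩ := agent_hom_agent u
        exact ⟨.forkR n, h, _, rfl⟩
    · rintro ⟨w, h, g, rfl⟩
      obtain ⟨rfl, rfl⟩ | ⟨rfl, rfl⟩ := act_hom_fork g
      · exact .inl ⟨eqToHom (by rw [h]; rfl), by simp⟩
      · exact .inr ⟨eqToHom (by rw [h]; rfl), by simp⟩
  agent_t f := by
    constructor
    · rintro ⟨u, rfl⟩
      obtain ⟨h, rfl⟩ := agent_hom_agent u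
      exact ⟨.forkL n, h, arr (.left n), rfl⟩
    · rintro ⟨w, h, g, rfl⟩
      obtain ⟨rfl, rfl⟩ | ⟨rfl, rfl⟩ := act_hom_fork g
      · exact ⟨eqToHom (by rw [h]), rfl⟩
      · exact ⟨eqToHom (by rw [h]), by rw [eqToHom_refl, Category.id_comp, ← rel_fork]; rfl⟩

theorem recvChan_eq_inl {n m : ℕ} {a : Fin n} {c d i : Fin m} {k : Fin (n + 1)}
    (h : recvChan a c d k = .inl i) : (k = a.castSucc ∧ i = c) ∨ (k = Fin.last n ∧ i = d) := by
  unfold recvChan at h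
  split_ifs at h <;> grind

theorem recvChan_eq {n m : ℕ} {a : Fin n} {c d : Fin m} {k l : Fin (n + 1)}
    (h : recvChan a c d k = recvChan a c d l) :
    k = l ∨ (k = a.castSucc ∧ l = Fin.last n ∧ c = d) ∨
      (k = Fin.last n ∧ l = a.castSucc ∧ c = d) := by
  unfold recvChan at h
  split_ifs at h <;> grind

theorem sync_object_chan (n : ℕ) (a : Fin n) (m : ℕ) (c d : Fin m) :
    arr (.chan (n + 1) (Fin.last n)) ≫ arr (.src (.inp n a)) ≫ arr (.recv n a m c d)
      = arr (.chan m d) ≫ arr (.tgt (.out m c d)) ≫ arr (.send n a m c d) := by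
  have e := congrArg (fun z => z ≫ arr (.send n a m c d)) (rel_src_tgt (.out m c d) d)
  simp only [Category.assoc] at e
  exact (rel_sync_object n a m c d).trans e

theorem sync_label_ne {n : ℕ} {a : Fin n} {m : ℕ} {c d : Fin m} {k : ℕ}
    (x : ob (.agent k) ⟶ ob (.act (.out m c d))) (y : ob (.agent k) ⟶ ob (.act (.inp n a))) :
    x ≫ arr (.send n a m c d) ≠ y ≫ arr (.recv n a m c d) := by
  intro h
  have := congrArg label h
  rw [label_comp, label_comp] at this
  exact absurd (congrArg Prod.snd this) Bool.noConfusion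

theorem seedSpec_sync (n : ℕ) (a : Fin n) (m : ℕ) (c d : Fin m) :
    SeedSpec (syncFinal n a m c d) (syncInitial n a m c d) where
  one_lt_dim := by simp
  mono_s := by
    refine mono_twoAgentsDesc (fun i j h => ?_) (fun i j h => ?_) (fun i j h => ?_)
      (fun k x y h => ?_)
    · have := congrArg chanIdx h
      rw [chanIdx_chan_comp_edge₂, chanIdx_chan_comp_edge₂] at this
      exact Sum.inl_injective this
    · have := congrArg chanIdx h
      rw [chanIdx_chan_comp_edge₂, chanIdx_chan_comp_edge₂] at this
      rcases recvChan_eq this with h | ⟨rfl, rfl, hcd⟩ | ⟨rfl, rfl, hcd⟩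
      · exact .inl h
      -- If `c = d`, the `a`-th and the last channel of the receiver are already shared.
      · exact .inr ⟨0, 1, rfl, rfl, hcd⟩
      · exact .inr ⟨1, 0, rfl, rfl, hcd.symm⟩
    · have := congrArg chanIdx h
      rw [chanIdx_chan_comp_edge₂, chanIdx_chan_comp_edge₂] at this
      rcases recvChan_eq_inl this.symm with ⟨h1, h2⟩ | ⟨h1, h2⟩
      · exact ⟨0, h2, h1⟩
      · exact ⟨1, h2, h1⟩
    · rw [← Category.assoc, ← Category.assoc] at h
      exact sync_label_ne _ _ h
  mono_t := by
    refine mono_twoAgentsDesc (fun i j h => ?_) (fun i j h => .inl ?_) (fun i j h => ?_)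
      (fun k x y h => ?_)
    · have := congrArg chanIdx h
      rw [chanIdx_chan_comp_edge₂, chanIdx_chan_comp_edge₂] at this
      exact Fin.castAdd_injective _ _ (Sum.inl_injective this)
    · have := congrArg chanIdx h
      rw [chanIdx_chan_comp_edge₂, chanIdx_chan_comp_edge₂] at this
      rcases recvChan_eq this with h | ⟨-, h, -⟩ | ⟨h, -, -⟩
      · exact Fin.castAdd_injective _ _ h
      · exact absurd h (Fin.castSucc_lt_last j).ne
      · exact absurd h (Fin.castSucc_lt_last i).ne
    · have := congrArg chanIdx h
      rw [chanIdx_chan_comp_edge₂, chanIdx_chan_comp_edge₂] at this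
      rcases recvChan_eq_inl this.symm with ⟨h1, h2⟩ | ⟨h1, -⟩
      · exact ⟨0, Fin.castAdd_injective _ _ h2, Fin.castSucc_injective _ h1⟩
      · exact absurd h1 (Fin.castSucc_lt_last j).ne
    · rw [← Category.assoc, ← Category.assoc] at h
      exact sync_label_ne _ _ h
  dim_s u := dim_le_of_twoAgents u
  dim_t u := dim_le_of_twoAgents u
  star_s f := by
    rw [syncFinal, exists_twoAgentsDesc_iff, ← chanOf_chanIdx f]
    rcases chanIdx f with k | k
    · exact .inl ⟨_, rfl⟩
    · exact .inr ⟨_, rfl⟩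
  star_t f := by
    refine ⟨fun _ h => h, fun _ => ?_⟩
    rw [syncInitial, exists_twoAgentsDesc_iff, ← chanOf_chanIdx f]
    rcases chanIdx f with k | k
    · refine .inl ⟨arr (.chan m k), ?_⟩
      have e := congrArg (fun z => z ≫ arr (.send n a m c d)) (rel_src_tgt (.out m c d) k)
      simp only [Category.assoc] at e
      exact e.symm
    · change Fin (n + 1) at k
      induction k using Fin.lastCases with
      | last => exact .inl ⟨_, (sync_object_chan n a m c d).symm⟩
      | cast k =>
        refine .inr ⟨arr (.chan n k), ?_⟩
        have e := congrArg (fun z => z ≫ arr (.recv n a m c d)) (rel_src_tgt (.inp n a) k)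
        simp only [Category.assoc] at e
        exact e.symm
  star_agent := exists_agent_of_twoAgents
  agent_s f := by
    rw [syncFinal, exists_twoAgentsDesc_iff]
    constructor
    · rintro (⟨u, rfl⟩ | ⟨u, rfl⟩)
      · obtain ⟨h, rfl⟩ := agent_hom_agent u
        exact ⟨.out m c d, h, _, rfl⟩
      · obtain ⟨h, rfl⟩ := agent_hom_agent u
        exact ⟨.inp n a, h, _, rfl⟩
    · rintro ⟨w, h, g, rfl⟩
      obtain ⟨rfl, rfl⟩ | ⟨rfl, rfl⟩ := act_hom_sync g
      · exact .inr ⟨eqToHom (by rw [h]), by simp⟩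
      · exact .inl ⟨eqToHom (by rw [h]; rfl), by simp⟩
  agent_t f := by
    rw [syncInitial, exists_twoAgentsDesc_iff]
    constructor
    · rintro (⟨u, rfl⟩ | ⟨u, rfl⟩)
      · obtain ⟨h, rfl⟩ := agent_hom_agent u
        exact ⟨.out m c d, h, _, rfl⟩
      · obtain ⟨h, rfl⟩ := agent_hom_agent u
        exact ⟨.inp n a, h, _, rfl⟩
    · rintro ⟨w, h, g, rfl⟩
      obtain ⟨rfl, rfl⟩ | ⟨rfl, rfl⟩ := act_hom_sync g
      · exact .inr ⟨eqToHom (by rw [h]), by simp⟩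
      · exact .inl ⟨eqToHom (by rw [h]), by simp⟩

theorem IsSeed.spec {Y X : Psh} {c : Base} {s : Y ⟶ rep c} {t : X ⟶ rep c} (h : IsSeed s t) :
    SeedSpec s t := by
  cases h with
  | act v => exact seedSpec_act v
  | fork n => exact seedSpec_fork n
  | sync n a m c d => exact seedSpec_sync n a m c d

theorem exists_isSeed {c : Base} (hc : 1 < dim c) :
    ∃ (Y X : Psh) (s : Y ⟶ rep c) (t : X ⟶ rep c), IsSeed s t := by
  induction c using Base.rec_ob with | _ y
  cases y with
  | star => exact absurd hc (by simp)
  | agent => exact absurd hc (by simp)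
  | act v => exact ⟨_, _, _, _, .act v⟩
  | fork n => exact ⟨_, _, _, _, .fork n⟩
  | sync n a m c d => exact ⟨_, _, _, _, .sync n a m c d⟩

/-! ### The positions of a seed -/

/-- The channels of a representable presheaf that are not created. -/
def IsInterface {d c : Base} (f : d ⟶ c) : Prop :=
  ∃ h : ob .star = d, ¬ IsFresh (eqToHom h ≫ f)

/-- The elements of a representable presheaf that are no longer there after the action: those of
dimension at least two, and the agents before the action. -/
def IsSpent {d c : Base} (f : d ⟶ c) : Prop :=
  1 < dim d ∨ ∃ (k : ℕ) (h : ob (.agent k) = d), IsTgt (eqToHom h ≫ f)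

theorem isInterface_star {c : Base} (f : ob .star ⟶ c) : IsInterface f ↔ ¬ IsFresh f := by
  simp [IsInterface]

theorem IsInterface.dim_eq {d c : Base} {f : d ⟶ c} (h : IsInterface f) : dim d = 0 := by
  obtain ⟨rfl, -⟩ := h
  rfl

theorem ob_agent_injective {k l : ℕ} (h : ob (.agent k) = ob (.agent l)) : k = l := by
  have : (Ob.agent k) = Ob.agent l := congrArg (fun c : Base => c.as) h
  injection this

theorem isSpent_agent {k : ℕ} {c : Base} (f : ob (.agent k) ⟶ c) : IsSpent f ↔ IsTgt f := by
  constructor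
  · rintro (h | ⟨l, h, hf⟩)
    · exact absurd h (by simp)
    · obtain rfl := ob_agent_injective h
      simpa using hf
  · intro h
    exact .inr ⟨k, rfl, by simpa using h⟩

theorem not_isSpent_star {c : Base} (f : ob .star ⟶ c) : ¬ IsSpent f := by
  rintro (h | ⟨l, h, _⟩)
  · exact absurd h (by simp)
  · exact absurd (congrArg dim h) (by simp)

theorem IsSrc.not_isSpent {k : ℕ} {c : Base} {f : ob (.agent k) ⟶ c} (h : IsSrc f) :
    ¬ IsSpent f := fun h' => not_isTgt_of_isSrc h ((isSpent_agent f).1 h')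

theorem dim_le_of_not_isSpent {d c : Base} {f : d ⟶ c} (h : ¬ IsSpent f) : dim d ≤ 1 :=
  not_lt.1 fun h' => h (.inl h')

theorem eq_star_of_dim {d : Base} (h : dim d = 0) : d = ob .star := by
  rcases eq_of_dim_le_one (h.le.trans zero_le_one) with h' | ⟨n, rfl⟩
  · exact h'
  · exact absurd h (by simp)

theorem eq_agent_of_dim {d : Base} (h : dim d = 1) : ∃ n, d = ob (.agent n) := by
  rcases eq_of_dim_le_one h.le with rfl | h'
  · exact absurd h (by simp)
  · exact h'

namespace SeedSpec

variable {Y X : Psh} {c : Base} {s : Y ⟶ rep c} {t : X ⟶ rep c} (h : SeedSpec s t)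

include h

theorem exists_interface_iff {d : Base} (f : d ⟶ c) :
    (∃ i : El (interface X) d, ap (interfaceι X ≫ t) i = f) ↔ IsInterface f := by
  constructor
  · rintro ⟨i, rfl⟩
    obtain rfl := eq_star_of_dim i.2
    rw [isInterface_star]
    exact (h.star_t _).1 ⟨i.1, rfl⟩
  · rintro ⟨rfl, hf⟩
    rw [eqToHom_refl, Category.id_comp] at hf
    obtain ⟨u, hu⟩ := (h.star_t _).2 hf
    exact ⟨⟨u, dim_star⟩, hu⟩

theorem exists_s_iff {d : Base} (f : d ⟶ c) : (∃ u : El Y d, ap s u = f) ↔ ¬ IsSpent f := by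
  constructor
  · rintro ⟨u, rfl⟩
    obtain rfl | ⟨k, rfl⟩ := eq_of_dim_le_one (h.dim_s u)
    · exact not_isSpent_star _
    · exact IsSrc.not_isSpent ((h.agent_s _).1 ⟨u, rfl⟩)
  · intro hf
    obtain rfl | ⟨k, rfl⟩ := eq_of_dim_le_one (dim_le_of_not_isSpent hf)
    · exact h.star_s f
    · refine (h.agent_s f).2 ((isSrc_or_isTgt h.one_lt_dim f).resolve_right fun ht => ?_)
      exact hf ((isSpent_agent f).2 ht)

theorem exists_t_iff {d : Base} (f : d ⟶ c) :
    (∃ u : El X d, ap t u = f) ↔ IsInterface f ∨ dim d = 1 ∧ IsSpent f := by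
  constructor
  · rintro ⟨u, rfl⟩
    obtain rfl | ⟨k, rfl⟩ := eq_of_dim_le_one (h.dim_t u)
    · exact .inl ((isInterface_star _).2 ((h.star_t _).1 ⟨u, rfl⟩))
    · exact .inr ⟨rfl, (isSpent_agent _).2 ((h.agent_t _).1 ⟨u, rfl⟩)⟩
  · rintro (⟨rfl, hf⟩ | ⟨hd, hf⟩)
    · rw [eqToHom_refl, Category.id_comp] at hf
      exact (h.star_t f).2 hf
    · obtain ⟨k, rfl⟩ := eq_agent_of_dim hd
      exact (h.agent_t f).2 ((isSpent_agent f).1 hf)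

theorem mono_interface : Mono (interfaceι X ≫ t) :=
  have := h.mono_t
  mono_comp _ _

end SeedSpec

/-! ### Reformulation of the conditions -/

/-- Local 1-injectivity in terms of morphisms of the base category, without mention of seeds. -/
theorem locallyOneInjective_iff {U : Psh} :
    LocallyOneInjective U ↔ ∀ (c : Base) (μ : El U c), IsCore U μ → ∀ (d : Base) (f g : d ⟶ c),
      res U f μ = res U g μ → f = g ∨ IsInterface f ∧ IsInterface g := by
  constructor
  · intro h c μ hμ d f g e
    obtain ⟨Y, X, s, t, hst⟩ := exists_isSeed hμ.1
    by_cases hfg : f = g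
    · exact .inl hfg
    · obtain ⟨h1, h2⟩ := h Y X c s t hst μ hμ d f g hfg e
      exact .inr ⟨(hst.spec.exists_interface_iff f).1 h1, (hst.spec.exists_interface_iff g).1 h2⟩
  · intro h Y X c s t hst μ hμ d f g hfg e
    obtain ⟨h1, h2⟩ := (h c μ hμ d f g e).resolve_left hfg
    exact ⟨(hst.spec.exists_interface_iff f).2 h1, (hst.spec.exists_interface_iff g).2 h2⟩

theorem isInitialEl_dim {U : Psh} {c : Base} {x : El U c} (h : IsInitialEl U x) : dim c ≤ 1 := by
  cases h <;> simp

/-- An agent is initial if it is no source of any element, of whatever dimension. -/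
theorem isInitialEl_agent_iff {U : Psh} {n : ℕ} (x : El U (ob (.agent n))) :
    IsInitialEl U x ↔ ∀ (c : Base) (ν : El U c), ¬ IsSource U ν ⟨n, x⟩ := by
  constructor
  · rintro ⟨_, _, h⟩ c ν ⟨v, f, e⟩
    exact h v _ e
  · intro h
    refine .agent n x fun v ν e => h _ ν ⟨v, 𝟙 _, ?_⟩
    rw [e, res_id]

/-- An agent is final if it is no target of any element, of whatever dimension. -/
theorem isFinalEl_agent_iff {U : Psh} {n : ℕ} (x : El U (ob (.agent n))) :
    IsFinalEl U x ↔ ∀ (c : Base) (ν : El U c), ¬ IsTarget U ν ⟨n, x⟩ := by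
  constructor
  · rintro ⟨_, _, h⟩ c ν ⟨v, f, e⟩
    exact h v _ e
  · intro h
    refine .agent n x fun v ν e => h _ ν ⟨v, 𝟙 _, ?_⟩
    rw [e, res_id]

theorem isInitialEl_channel_iff {U : Psh} (a : Channel U) :
    IsInitialEl U a ↔ ∀ (c : Base) (ν : El U c), IsCore U ν → ¬ Creates U ν a := by
  constructor
  · intro h
    cases h with
    | channel _ h => exact h
  · exact .channel a

/-- Every element of dimension at least two lies below a core. -/
theorem exists_core {U : Psh} {c : Base} (x : El U c) (hc : 1 < dim c) :
    ∃ (d : Base) (f : c ⟶ d) (μ : El U d), IsCore U μ ∧ x = res U f μ := by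
  generalize hn : 4 - dim c = n
  induction n using Nat.strong_induction_on generalizing c with
  | _ n ih =>
    by_cases h : IsCore U x
    · exact ⟨c, 𝟙 c, x, h, (res_id U x).symm⟩
    · have : ∃ (d : Base) (f : c ⟶ d) (y : El U d), dim c < dim d ∧ res U f y = x := by
        by_contra hx
        exact h ⟨hc, fun d f y hd e => hx ⟨d, f, y, hd, e⟩⟩
      obtain ⟨d, f, y, hd, rfl⟩ := this
      have := dim_le_four d
      obtain ⟨e, g, μ, hμ, rfl⟩ := ih (4 - dim d) (by omega) y (hc.trans hd) rfl
      exact ⟨e, f ≫ g, μ, hμ, res_res U f g μ⟩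

theorem IsSource.of_res {U : Psh} {c d : Base} {f : c ⟶ d} {μ : El U d} {x : Agent U}
    (h : IsSource U (res U f μ) x) : IsSource U μ x := by
  obtain ⟨v, g, rfl⟩ := h
  exact ⟨v, g ≫ f, by rw [res_res U g f]⟩

theorem IsTarget.of_res {U : Psh} {c d : Base} {f : c ⟶ d} {μ : El U d} {x : Agent U}
    (h : IsTarget U (res U f μ) x) : IsTarget U μ x := by
  obtain ⟨v, g, rfl⟩ := h
  exact ⟨v, g ≫ f, by rw [res_res U g f]⟩

theorem IsSource.one_lt_dim {U : Psh} {c : Base} {μ : El U c} {x : Agent U}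
    (h : IsSource U μ x) : 1 < dim c := by
  obtain ⟨v, g, -⟩ := h
  exact lt_of_lt_of_le (by simp) (dim_le_of_hom g)

theorem IsTarget.one_lt_dim {U : Psh} {c : Base} {μ : El U c} {x : Agent U}
    (h : IsTarget U μ x) : 1 < dim c := by
  obtain ⟨v, g, -⟩ := h
  exact lt_of_lt_of_le (by simp) (dim_le_of_hom g)

/-- An element that is the source of something is the source of a core. -/
theorem IsSource.exists_core {U : Psh} {c : Base} {μ : El U c} {x : Agent U}
    (h : IsSource U μ x) : ∃ (d : Base) (f : c ⟶ d) (μ' : El U d), IsCore U μ' ∧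
      μ = res U f μ' ∧ IsSource U μ' x := by
  obtain ⟨d, f, μ', hμ', rfl⟩ := PiTrace.exists_core μ h.one_lt_dim
  exact ⟨d, f, μ', hμ', rfl, h.of_res⟩

theorem IsTarget.exists_core {U : Psh} {c : Base} {μ : El U c} {x : Agent U}
    (h : IsTarget U μ x) : ∃ (d : Base) (f : c ⟶ d) (μ' : El U d), IsCore U μ' ∧
      μ = res U f μ' ∧ IsTarget U μ' x := by
  obtain ⟨d, f, μ', hμ', rfl⟩ := PiTrace.exists_core μ h.one_lt_dim
  exact ⟨d, f, μ', hμ', rfl, h.of_res⟩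

/-- Linearity of the causal graph at the sources of cores. -/
theorem SourceLinear.eq_of_isSource {U : Psh} (h : SourceLinear (causalGraph U)) {c d : Base}
    {μ : El U c} {ν : El U d} (hμ : IsCore U μ) (hν : IsCore U ν) {x : Agent U}
    (h1 : IsSource U μ x) (h2 : IsSource U ν x) :
    Vertex.core c μ hμ = Vertex.core d ν hν :=
  h _ _ (.agent x) trivial trivial (.source c μ hμ x h1) (.source d ν hν x h2)

theorem SourceLinear.eq_of_creates {U : Psh} (h : SourceLinear (causalGraph U)) {c d : Base}
    {μ : El U c} {ν : El U d} (hμ : IsCore U μ) (hν : IsCore U ν) {x : Channel U}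
    (h1 : Creates U μ x) (h2 : Creates U ν x) :
    Vertex.core c μ hμ = Vertex.core d ν hν :=
  h _ _ (.channel x) trivial trivial (.created c μ hμ x h1) (.created d ν hν x h2)

theorem TargetLinear.eq_of_isTarget {U : Psh} (h : TargetLinear (causalGraph U)) {c d : Base}
    {μ : El U c} {ν : El U d} (hμ : IsCore U μ) (hν : IsCore U ν) {x : Agent U}
    (h1 : IsTarget U μ x) (h2 : IsTarget U ν x) :
    Vertex.core c μ hμ = Vertex.core d ν hν :=
  h _ _ (.agent x) trivial trivial trivial (.target c μ hμ x h1) (.target d ν hν x h2)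

/-- To check linearity, compare two cores with a common source, created channel, or target. -/
theorem linear_of {U : Psh}
    (h1 : ∀ {c d : Base} (μ : El U c) (ν : El U d) (hμ : IsCore U μ) (hν : IsCore U ν)
      (x : Agent U), IsSource U μ x → IsSource U ν x → Vertex.core c μ hμ = Vertex.core d ν hν)
    (h2 : ∀ {c d : Base} (μ : El U c) (ν : El U d) (hμ : IsCore U μ) (hν : IsCore U ν)
      (a : Channel U), Creates U μ a → Creates U ν a → Vertex.core c μ hμ = Vertex.core d ν hν)
    (h3 : ∀ {c d : Base} (μ : El U c) (ν : El U d) (hμ : IsCore U μ) (hν : IsCore U ν)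
      (x : Agent U), IsTarget U μ x → IsTarget U ν x → Vertex.core c μ hμ = Vertex.core d ν hν) :
    Linear (causalGraph U) := by
  constructor
  · intro μ μ' x hμ hμ' e e'
    rcases μ with _ | _ | ⟨c, μ, h⟩
    · exact hμ.elim
    · exact hμ.elim
    rcases μ' with _ | _ | ⟨c', μ', h'⟩
    · exact hμ'.elim
    · exact hμ'.elim
    change CausalAdj U _ _ at e e'
    cases e with
    | source _ _ _ x hx =>
      cases e' with
      | source _ _ _ _ hx' => exact h1 _ _ _ _ _ hx hx'
    | created _ _ _ x hx =>
      cases e' with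
      | created _ _ _ _ hx' => exact h2 _ _ _ _ _ hx hx'
  · intro μ μ' x hμ hμ' _ e e'
    rcases μ with _ | _ | ⟨c, μ, h⟩
    · exact hμ.elim
    · exact hμ.elim
    rcases μ' with _ | _ | ⟨c', μ', h'⟩
    · exact hμ'.elim
    · exact hμ'.elim
    change CausalAdj U _ _ at e e'
    cases e with
    | target _ _ _ x hx =>
      cases e' with
      | target _ _ _ _ hx' => exact h3 _ _ _ _ _ hx hx'

/-- The reversed edge relation of the causal graph, which goes forward in time. -/
def Later (U : Psh) (x y : Vertex U) : Prop := CausalAdj U y x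

/-- The conditions of the correctness criterion, acyclicity being replaced by well-foundedness. -/
structure IsCorrect {Y U X : Psh} (s : Y ⟶ U) (t : X ⟶ U) : Prop where
  loc : LocallyOneInjective U
  init : ContainsExactlyInitial t
  final : ContainsExactlyFinal s
  linear : Linear (causalGraph U)
  wf : WellFounded (Later U)

/-! ### Removing a core -/

section Mono

variable {A W : Psh} (i : A ⟶ W) [Mono i]

theorem isSource_ap_iff {c : Base} (μ : El A c) {k : ℕ} (x : El A (ob (.agent k))) :
    IsSource W (ap i μ) ⟨k, ap i x⟩ ↔ IsSource A μ ⟨k, x⟩ := by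
  simp only [isSource_iff_exists_isSrc, ← ap_res]
  exact exists_congr fun f => and_congr_right fun _ => ⟨ap_injective i, congrArg _⟩

theorem isTarget_ap_iff {c : Base} (μ : El A c) {k : ℕ} (x : El A (ob (.agent k))) :
    IsTarget W (ap i μ) ⟨k, ap i x⟩ ↔ IsTarget A μ ⟨k, x⟩ := by
  simp only [isTarget_iff_exists_isTgt, ← ap_res]
  exact exists_congr fun f => and_congr_right fun _ => ⟨ap_injective i, congrArg _⟩

theorem creates_ap_iff {c : Base} (μ : El A c) (a : Channel A) :
    Creates W (ap i μ) (ap i a) ↔ Creates A μ a := by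
  simp only [creates_iff, ← ap_res]
  exact exists_congr fun f => and_congr_right fun _ => ⟨ap_injective i, congrArg _⟩

omit [Mono i] in
theorem exists_of_isSource_ap {c : Base} {μ : El A c} {k : ℕ} {x : El W (ob (.agent k))}
    (h : IsSource W (ap i μ) ⟨k, x⟩) : ∃ y, ap i y = x := by
  obtain ⟨f, -, rfl⟩ := (isSource_iff_exists_isSrc _ _ _).1 h
  exact ⟨_, ap_res i f μ⟩

omit [Mono i] in
theorem exists_of_isTarget_ap {c : Base} {μ : El A c} {k : ℕ} {x : El W (ob (.agent k))}
    (h : IsTarget W (ap i μ) ⟨k, x⟩) : ∃ y, ap i y = x := by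
  obtain ⟨f, -, rfl⟩ := (isTarget_iff_exists_isTgt _ _ _).1 h
  exact ⟨_, ap_res i f μ⟩

end Mono

/-- The subpresheaf `A` of `W` consists of what remains of `W` after the action of the core `μ`,
which identifies at most channels of its interface. -/
structure Removal {A W : Psh} (i : A ⟶ W) {c : Base} (μ : El W c) : Prop where
  mono : Mono i
  core : IsCore W μ
  inj : ∀ {d : Base} (f g : d ⟶ c), res W f μ = res W g μ → f = g ∨ IsInterface f ∧ IsInterface g
  range : ∀ {d : Base} (x : El W d),
    (∃ y, ap i y = x) ↔ ¬ ∃ f : d ⟶ c, IsSpent f ∧ x = res W f μ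

namespace Removal

variable {A W : Psh} {i : A ⟶ W} {c : Base} {μ : El W c} (h : Removal i μ)

include h

theorem mem_or {d : Base} (x : El W d) :
    (∃ y, ap i y = x) ∨ ∃ f : d ⟶ c, IsSpent f ∧ x = res W f μ := by
  rw [h.range]
  exact (em _).symm

theorem exists_channel (a : Channel W) : ∃ y, ap i y = a := by
  rw [h.range]
  rintro ⟨f, hf, -⟩
  exact not_isSpent_star f hf

theorem ap_ne {d : Base} {f : d ⟶ c} (hf : IsSpent f) (y : El A d) : ap i y ≠ res W f μ :=
  fun e => (h.range _).1 ⟨y, e⟩ ⟨f, hf, rfl⟩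

theorem ap_ne_core (y : El A c) : ap i y ≠ μ := fun e =>
  h.ap_ne (f := 𝟙 c) (.inl h.core.1) y (by rw [e, res_id])

theorem mem_or_eq_res {d : Base} (x : El W d) :
    (∃ y, ap i y = x) ∨ ∃ f : d ⟶ c, x = res W f μ := by
  obtain h | ⟨f, -, h⟩ := h.mem_or x
  · exact .inl h
  · exact .inr ⟨f, h⟩

theorem isCore_ap_iff {d : Base} (y : El A d) : IsCore W (ap i y) ↔ IsCore A y := by
  have := h.mono
  constructor
  · rintro ⟨hd, hy⟩
    refine ⟨hd, fun e f z he hz => hy e f (ap i z) he ?_⟩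
    rw [← ap_res, hz]
  · rintro ⟨hd, hy⟩
    refine ⟨hd, fun e f z he hz => ?_⟩
    obtain ⟨z, rfl⟩ | ⟨g, rfl⟩ := h.mem_or_eq_res z
    · rw [← ap_res] at hz
      exact hy e f z he (ap_injective i hz)
    · rw [res_res] at hz
      exact h.ap_ne (f := f ≫ g) (.inl hd) y hz.symm

/-- The cores of `W` are `μ` and those of `A`. -/
theorem core_cases {d : Base} (x : El W d) (hx : IsCore W x) :
    (∃ e : c = d, e ▸ μ = x) ∨ ∃ y, IsCore A y ∧ ap i y = x := by
  obtain ⟨y, rfl⟩ | ⟨f, rfl⟩ := h.mem_or_eq_res x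
  · exact .inr ⟨y, (h.isCore_ap_iff y).1 hx, rfl⟩
  · obtain ⟨rfl, rfl⟩ | hlt := eq_or_dim_lt f
    · exact .inl ⟨rfl, by rw [eqToHom_refl, res_id]⟩
    · exact absurd rfl (hx.2 c f μ hlt)

theorem isTarget_of_ap_ne {k : ℕ} {x : El W (ob (.agent k))} (hx : ¬ ∃ y, ap i y = x) :
    IsTarget W μ ⟨k, x⟩ := by
  obtain ⟨f, hf, rfl⟩ := (h.mem_or x).resolve_left hx
  exact (isTarget_iff_exists_isTgt _ _ _).2 ⟨f, (isSpent_agent f).1 hf, rfl⟩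

theorem not_isTarget_ap {k : ℕ} (y : El A (ob (.agent k))) : ¬ IsTarget W μ ⟨k, ap i y⟩ := by
  intro ht
  obtain ⟨f, hf, e⟩ := (isTarget_iff_exists_isTgt _ _ _).1 ht
  exact h.ap_ne ((isSpent_agent f).2 hf) y e

/-- A target of `μ` is not a source of anything in `A`, nor of `μ`. -/
theorem not_isSource_of_isTarget {k : ℕ} {x : El W (ob (.agent k))} (hx : IsTarget W μ ⟨k, x⟩)
    {d : Base} (ν : El W d) : ¬ IsSource W ν ⟨k, x⟩ := by
  intro hs
  obtain ⟨y, rfl⟩ | ⟨g, rfl⟩ := h.mem_or_eq_res ν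
  · obtain ⟨z, rfl⟩ := exists_of_isSource_ap i hs
    exact h.not_isTarget_ap z hx
  · obtain ⟨f, hf, rfl⟩ := (isTarget_iff_exists_isTgt _ _ _).1 hx
    obtain ⟨f', hf', e⟩ := (isSource_iff_exists_isSrc _ _ _).1 hs.of_res
    rcases h.inj f f' e with rfl | ⟨hi, -⟩
    · exact not_isTgt_of_isSrc hf' hf
    · exact absurd hi.dim_eq (by simp)

/-- `A` and `W` have the same final agents and channels. -/
theorem isFinalEl_iff {d : Base} (x : El W d) :
    IsFinalEl W x ↔ ∃ y, IsFinalEl A y ∧ ap i y = x := by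
  have := h.mono
  constructor
  · intro hx
    rcases hx with ⟨n, x, hx⟩ | ⟨x⟩
    · have hx := (isFinalEl_agent_iff x).1 (.agent n x hx)
      have hm : ∃ y, ap i y = x := by
        by_contra hm
        exact hx _ μ (h.isTarget_of_ap_ne hm)
      obtain ⟨y, rfl⟩ := hm
      refine ⟨y, (isFinalEl_agent_iff y).2 fun d ν hν => hx d (ap i ν) ?_, rfl⟩
      exact (isTarget_ap_iff i ν y).2 hν
    · obtain ⟨y, rfl⟩ := h.exists_channel x
      exact ⟨y, .channel y, rfl⟩
  · rintro ⟨y, hy, rfl⟩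
    rcases hy with ⟨n, y, hy⟩ | ⟨y⟩
    · have hy := (isFinalEl_agent_iff y).1 (.agent n y hy)
      refine (isFinalEl_agent_iff _).2 fun d ν hν => ?_
      obtain ⟨z, rfl⟩ | ⟨f, rfl⟩ := h.mem_or_eq_res ν
      · exact hy _ z ((isTarget_ap_iff i z y).1 hν)
      · exact h.not_isTarget_ap y hν.of_res
    · exact .channel _

/-- The inclusion of the vertices of the causal graph of `A`. -/
def vertex : Vertex A → Vertex W
  | .channel a => .channel (ap i a)
  | .agent x => .agent ⟨x.1, ap i x.2⟩
  | .core d ν hν => .core d (ap i ν) ((h.isCore_ap_iff ν).2 hν)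

theorem vertex_injective : Function.Injective h.vertex := by
  have := h.mono
  intro v w e
  rcases v with a | ⟨k, x⟩ | ⟨d, ν, hν⟩ <;> rcases w with b | ⟨l, y⟩ | ⟨d', ξ, hξ⟩
  case channel.channel =>
    injection e with e
    rw [ap_injective i e]
  case agent.agent =>
    injection e with e
    injection e with h1 h2
    subst h1
    obtain rfl : x = y := ap_injective i (eq_of_heq h2)
    rfl
  case core.core =>
    injection e with h1 h2
    subst h1
    obtain rfl := ap_injective i (eq_of_heq h2)
    rfl
  all_goals injection e

theorem vertex_adj {v w : Vertex A} (e : CausalAdj A v w) :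
    CausalAdj W (h.vertex v) (h.vertex w) := by
  have := h.mono
  cases e with
  | agent_channel n x j =>
    simp only [vertex, ap_res]
    exact .agent_channel n _ j
  | source d ν hν x hx => exact .source _ _ _ _ ((isSource_ap_iff i ν x.2).2 hx)
  | created d ν hν a ha => exact .created _ _ _ _ ((creates_ap_iff i ν a).2 ha)
  | target d ν hν x hx => exact .target _ _ _ _ ((isTarget_ap_iff i ν x.2).2 hx)

/-- The edges of the causal graph of `W` out of a vertex of `A` lead to vertices of `A`,
or to `μ`. -/
theorem adj_vertex {v : Vertex A} {w : Vertex W} (e : CausalAdj W (h.vertex v) w) :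
    (∃ w', h.vertex w' = w ∧ CausalAdj A v w') ∨ w = .core c μ h.core := by
  have := h.mono
  rcases v with a | ⟨k, x⟩ | ⟨d, ν, hν⟩
  · simp only [vertex] at e
    cases e with
    | created d ν hν a ha =>
      obtain ⟨rfl, rfl⟩ | ⟨y, hy, rfl⟩ := h.core_cases ν hν
      · exact .inr rfl
      · exact .inl ⟨.core d y hy, rfl, .created _ _ _ _ ((creates_ap_iff i y a).1 ha)⟩
  · simp only [vertex] at e
    cases e with
    | agent_channel _ _ j =>
      exact .inl ⟨.channel (res A (arr (.chan k j)) x), by simp only [vertex, ap_res],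
        .agent_channel k x j⟩
    | source d ν hν _ hx =>
      obtain ⟨rfl, rfl⟩ | ⟨y, hy, rfl⟩ := h.core_cases ν hν
      · exact .inr rfl
      · exact .inl ⟨.core d y hy, rfl, .source _ _ _ _ ((isSource_ap_iff i y x).1 hx)⟩
  · simp only [vertex] at e
    cases e with
    | target _ _ _ x hx =>
      obtain ⟨l, x⟩ := x
      obtain ⟨y, rfl⟩ := exists_of_isTarget_ap i hx
      exact .inl ⟨.agent ⟨l, y⟩, rfl, .target _ _ _ _ ((isTarget_ap_iff i ν y).1 hx)⟩

end Removal

/-! ### Steps -/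

/-- The position `Z` is reached from the position `X` by the action of the core `μ`, after which
`A` remains of `W`: below `μ`, the position `X` contains the interface and the targets, while `Z`
consists of the part of `X` lying in `A` and of the elements below `μ` that are not spent. -/
structure Step {A W Z X : Psh} (i : A ⟶ W) {c : Base} (μ : El W c) (z : Z ⟶ A) (t : X ⟶ W) : Prop
    extends Removal i μ where
  dim_X : ∀ {d : Base}, El X d → dim d ≤ 1
  before : ∀ {d : Base} (f : d ⟶ c),
    (∃ u, ap t u = res W f μ) ↔ IsInterface f ∨ dim d = 1 ∧ IsSpent f
  after : ∀ {d : Base} (y : El A d),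
    (∃ u, ap z u = y) ↔ (∃ u, ap t u = ap i y) ∨ ∃ f, ¬ IsSpent f ∧ ap i y = res W f μ

theorem mem_range_iff {X U : Psh} (t : X ⟶ U) {c : Base} (x : El U c) :
    x ∈ Set.range (t.app (op c)) ↔ ∃ u, ap t u = x := Iff.rfl

namespace Step

variable {A W Z X Y : Psh} {i : A ⟶ W} {c : Base} {μ : El W c} {z : Z ⟶ A} {t : X ⟶ W} {s : Y ⟶ A}
  (h : Step i μ z t)

include h

theorem exists_t_of_isTarget {k : ℕ} {x : El W (ob (.agent k))} (hx : IsTarget W μ ⟨k, x⟩) :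
    ∃ u, ap t u = x := by
  obtain ⟨f, hf, rfl⟩ := (isTarget_iff_exists_isTgt _ _ _).1 hx
  exact (h.before f).2 (.inr ⟨rfl, (isSpent_agent f).2 hf⟩)

theorem not_exists_t_of_isSource {k : ℕ} {x : El W (ob (.agent k))} (hx : IsSource W μ ⟨k, x⟩) :
    ¬ ∃ u, ap t u = x := by
  obtain ⟨f, hf, rfl⟩ := (isSource_iff_exists_isSrc _ _ _).1 hx
  rw [h.before f]
  rintro (hi | ⟨-, hs⟩)
  · exact absurd hi.dim_eq (by simp)
  · exact hf.not_isSpent hs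

theorem not_exists_t_of_creates {x : Channel W} (hx : Creates W μ x) :
    ¬ ∃ u, ap t u = x := by
  obtain ⟨f, hf, rfl⟩ := (creates_iff _ _).1 hx
  rw [h.before f]
  rintro (hi | ⟨hd, -⟩)
  · exact (isInterface_star f).1 hi hf
  · exact absurd hd (by simp)

theorem after_agent {k : ℕ} (y : El A (ob (.agent k))) :
    (∃ u, ap z u = y) ↔ (∃ u, ap t u = ap i y) ∨ IsSource W μ ⟨k, ap i y⟩ := by
  rw [h.after, isSource_iff_exists_isSrc]
  refine or_congr_right (exists_congr fun f => and_congr_left fun e => ?_)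
  refine ⟨fun hf => ?_, IsSrc.not_isSpent⟩
  exact (isSrc_or_isTgt h.core.1 f).resolve_right fun ht => hf ((isSpent_agent f).2 ht)

theorem after_channel (y : Channel A) :
    (∃ u, ap z u = y) ↔ (∃ u, ap t u = ap i y) ∨ Creates W μ (ap i y) := by
  rw [h.after, creates_iff]
  constructor
  · rintro (hy | ⟨f, -, e⟩)
    · exact .inl hy
    · by_cases hf : IsFresh f
      · exact .inr ⟨f, hf, e⟩
      · rw [e]
        exact .inl ((h.before f).2 (.inl ((isInterface_star f).2 hf)))
  · rintro (hy | ⟨f, hf, e⟩)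
    · exact .inl hy
    · exact .inr ⟨f, not_isSpent_star f, e⟩

/-- An agent or channel of `W` is initial if it is a target of `μ`, or initial in `A` and neither a
source of `μ` nor created by it. -/
theorem init_of (hz : ContainsExactlyInitial z) : ContainsExactlyInitial t := by
  have := h.mono
  intro d x
  rw [mem_range_iff]
  constructor
  · rintro ⟨u, rfl⟩
    obtain rfl | ⟨k, rfl⟩ := eq_of_dim_le_one (h.dim_X u)
    · rw [isInitialEl_channel_iff]
      intro d ν hν ha
      obtain ⟨rfl, rfl⟩ | ⟨y, hy, rfl⟩ := h.core_cases ν hν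
      · exact h.not_exists_t_of_creates ha ⟨u, rfl⟩
      · obtain ⟨a, e⟩ := h.exists_channel (ap t u)
        have ha' := (isInitialEl_channel_iff a).1
          ((hz _ a).1 ((h.after_channel a).2 (.inl ⟨u, e.symm⟩)))
        rw [← e, creates_ap_iff] at ha
        exact ha' _ y hy ha
    · rw [isInitialEl_agent_iff]
      intro d ν hν
      by_cases ha : ∃ a, ap i a = ap t u
      · obtain ⟨a, e⟩ := ha
        have ha' := (isInitialEl_agent_iff a).1
          ((hz _ a).1 ((h.after_agent a).2 (.inl ⟨u, e.symm⟩)))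
        obtain ⟨y, rfl⟩ | ⟨f, rfl⟩ := h.mem_or_eq_res ν
        · rw [← e, isSource_ap_iff] at hν
          exact ha' _ y hν
        · exact h.not_exists_t_of_isSource hν.of_res ⟨u, rfl⟩
      · exact h.not_isSource_of_isTarget (h.isTarget_of_ap_ne ha) ν hν
  · intro hx
    rcases hx with ⟨n, x, hx⟩ | ⟨x, hx⟩
    · have hx := (isInitialEl_agent_iff x).1 (.agent n x hx)
      by_cases ha : ∃ a, ap i a = x
      · obtain ⟨a, rfl⟩ := ha
        refine ((h.after_agent a).1 ((hz _ a).2 ?_)).resolve_right (hx _ μ)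
        exact (isInitialEl_agent_iff a).2 fun d ν hν => hx d _ ((isSource_ap_iff i ν a).2 hν)
      · exact h.exists_t_of_isTarget (h.isTarget_of_ap_ne ha)
    · obtain ⟨a, rfl⟩ := h.exists_channel x
      refine ((h.after_channel a).1 ((hz _ a).2 ?_)).resolve_right (hx _ μ h.core)
      exact .channel a fun d ν hν ha =>
        hx d _ ((h.isCore_ap_iff ν).2 hν) ((creates_ap_iff i ν a).2 ha)

/-- A core of `A` shares no source, created channel or target with `μ`. -/
theorem linear_of (hz : ContainsExactlyInitial z) (hA : Linear (causalGraph A)) :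
    Linear (causalGraph W) := by
  have := h.mono
  -- A source of `μ` is initial in `A`, hence not a source of a core of `A`.
  have hs : ∀ {d : Base} (y : El A d) (x : Agent W), IsSource W μ x → ¬ IsSource W (ap i y) x := by
    rintro d y ⟨k, x⟩ h1 h2
    obtain ⟨a, rfl⟩ := exists_of_isSource_ap i h2
    have := (isInitialEl_agent_iff a).1 ((hz _ a).1 ((h.after_agent a).2 (.inr h1)))
    exact this _ y ((isSource_ap_iff i y a).1 h2)
  have hc : ∀ {d : Base} (y : El A d) (x : Channel W), IsCore A y → Creates W μ x →
      ¬ Creates W (ap i y) x := by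
    intro d y x hy h1 h2
    obtain ⟨a, rfl⟩ := h.exists_channel x
    have := (isInitialEl_channel_iff a).1 ((hz _ a).1 ((h.after_channel a).2 (.inr h1)))
    exact this _ y hy ((creates_ap_iff i y a).1 h2)
  have ht : ∀ {d : Base} (y : El A d) (x : Agent W), IsTarget W μ x → ¬ IsTarget W (ap i y) x := by
    rintro d y ⟨k, x⟩ h1 h2
    obtain ⟨a, rfl⟩ := exists_of_isTarget_ap i h2
    exact h.not_isTarget_ap a h1
  have hv : ∀ {d e : Base} {y : El A d} {y' : El A e} {hy : IsCore A y} {hy' : IsCore A y'},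
      Vertex.core d y hy = Vertex.core e y' hy' → ∀ k k',
      Vertex.core d (ap i y) k = Vertex.core e (ap i y') k' :=
    fun e _ _ => congrArg h.vertex e
  refine PiTrace.linear_of (fun ν ν' hν hν' x h1 h2 => ?_) (fun ν ν' hν hν' x h1 h2 => ?_)
    (fun ν ν' hν hν' x h1 h2 => ?_) <;>
  obtain ⟨rfl, rfl⟩ | ⟨y, hy, rfl⟩ := h.core_cases ν hν <;>
  obtain ⟨rfl, rfl⟩ | ⟨y', hy', rfl⟩ := h.core_cases ν' hν'
  · rfl
  · exact absurd h2 (hs y' x h1)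
  · exact absurd h1 (hs y x h2)
  · obtain ⟨k, x⟩ := x
    obtain ⟨a, rfl⟩ := exists_of_isSource_ap i h1
    exact hv (hA.1.eq_of_isSource hy hy' ((isSource_ap_iff i y a).1 h1)
      ((isSource_ap_iff i y' a).1 h2)) _ _
  · rfl
  · exact absurd h2 (hc y' x hy' h1)
  · exact absurd h1 (hc y x hy h2)
  · obtain ⟨a, rfl⟩ := h.exists_channel x
    exact hv (hA.1.eq_of_creates hy hy' ((creates_ap_iff i y a).1 h1)
      ((creates_ap_iff i y' a).1 h2)) _ _
  · rfl
  · exact absurd h2 (ht y' x h1)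
  · exact absurd h1 (ht y x h2)
  · obtain ⟨k, x⟩ := x
    obtain ⟨a, rfl⟩ := exists_of_isTarget_ap i h1
    exact hv (hA.2.eq_of_isTarget hy hy' ((isTarget_ap_iff i y a).1 h1)
      ((isTarget_ap_iff i y' a).1 h2)) _ _

/-- Paths in the causal graph of `W` run through `A`, then possibly through `μ`, and end in the
initial position. -/
theorem wf_of (ht : ContainsExactlyInitial t) (hA : WellFounded (Later A)) :
    WellFounded (Later W) := by
  have := h.mono
  -- The vertices of the initial position have no edges to cores.
  have hc : ∀ a : Channel W, (∃ u, ap t u = a) → Acc (Later W) (.channel a) := by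
    intro a ha
    refine ⟨_, fun w e => ?_⟩
    change CausalAdj W _ _ at e
    cases e with
    | created d ν hν _ hν' =>
      exact absurd hν' ((isInitialEl_channel_iff a).1 ((ht _ a).1 ha) d ν hν)
  have ha : ∀ {k : ℕ} (x : El W (ob (.agent k))), (∃ u, ap t u = x) →
      Acc (Later W) (.agent ⟨k, x⟩) := by
    intro k x hx
    refine ⟨_, fun w e => ?_⟩
    change CausalAdj W _ _ at e
    cases e with
    | agent_channel _ _ j =>
      obtain ⟨u, rfl⟩ := hx
      exact hc _ ⟨_, ap_res t _ u⟩
    | source d ν hν _ hν' => exact absurd hν' ((isInitialEl_agent_iff x).1 ((ht _ x).1 hx) d ν)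
  have hμ : Acc (Later W) (.core c μ h.core) := by
    refine ⟨_, fun w e => ?_⟩
    change CausalAdj W _ _ at e
    cases e with
    | target _ _ _ x hx =>
      obtain ⟨k, x⟩ := x
      exact ha x (h.exists_t_of_isTarget hx)
  have hv : ∀ v : Vertex A, Acc (Later W) (h.vertex v) := by
    intro v
    induction v using hA.induction with
    | _ v ih =>
      refine ⟨_, fun w e => ?_⟩
      obtain ⟨w', rfl, e'⟩ | rfl := h.adj_vertex e
      · exact ih w' e'
      · exact hμ
  refine ⟨fun v => ?_⟩
  rcases v with a | ⟨k, x⟩ | ⟨d, ν, hν⟩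
  · obtain ⟨y, rfl⟩ := h.exists_channel a
    exact hv (.channel y)
  · by_cases hx : ∃ y, ap i y = x
    · obtain ⟨y, rfl⟩ := hx
      exact hv (.agent ⟨k, y⟩)
    · exact ha x (h.exists_t_of_isTarget (h.isTarget_of_ap_ne hx))
  · obtain ⟨rfl, rfl⟩ | ⟨y, hy, rfl⟩ := h.core_cases ν hν
    · exact hμ
    · exact hv (.core d y hy)

theorem final_of (hs : ContainsExactlyFinal s) : ContainsExactlyFinal (s ≫ i) := by
  intro d x
  rw [h.isFinalEl_iff]
  constructor
  · rintro ⟨u, rfl⟩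
    exact ⟨ap s u, (hs _ _).1 ⟨u, rfl⟩, rfl⟩
  · rintro ⟨y, hy, rfl⟩
    obtain ⟨u, rfl⟩ := (hs _ y).2 hy
    exact ⟨u, rfl⟩

/-- Adding a first action to a correct cospan yields a correct cospan. -/
theorem isCorrect_comp (hA : IsCorrect s z) : IsCorrect (s ≫ i) t where
  loc := by
    have := h.mono
    rw [locallyOneInjective_iff]
    intro d ν hν e f g hfg
    obtain ⟨rfl, rfl⟩ | ⟨y, hy, rfl⟩ := h.core_cases ν hν
    · exact h.inj f g hfg
    · rw [← ap_res, ← ap_res] at hfg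
      exact locallyOneInjective_iff.1 hA.loc d y hy e f g (ap_injective i hfg)
  init := h.init_of hA.init
  final := h.final_of hA.final
  linear := h.linear_of hA.init hA.linear
  wf := h.wf_of (h.init_of hA.init) hA.wf

/-- Removing a first action from a correct cospan yields a correct cospan. -/
theorem isCorrect_of_comp (hW : IsCorrect (s ≫ i) t) : IsCorrect s z where
  loc := by
    rw [locallyOneInjective_iff]
    intro d ν hν e f g hfg
    refine locallyOneInjective_iff.1 hW.loc d (ap i ν) ((h.isCore_ap_iff ν).2 hν) e f g ?_
    rw [← ap_res, ← ap_res, hfg]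
  -- By linearity, the sources of `μ` and the channels it creates become initial.
  init := by
    have := h.mono
    have hne : ∀ {d : Base} {y : El A d} {hy : IsCore W (ap i y)},
        Vertex.core d (ap i y) hy ≠ Vertex.core c μ h.core := by
      intro d y hy e
      injection e with h1 h2
      subst h1
      exact h.ap_ne_core y (eq_of_heq h2)
    intro d x
    rw [mem_range_iff]
    have hdim : (∃ u, ap z u = x) ∨ IsInitialEl A x → dim d ≤ 1 := by
      rintro (hx | hx)
      · obtain ⟨u, -⟩ | ⟨f, hf, -⟩ := (h.after x).1 hx
        · exact h.dim_X u
        · exact dim_le_of_not_isSpent hf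
      · exact isInitialEl_dim hx
    by_cases hd : dim d ≤ 1
    · obtain rfl | ⟨k, rfl⟩ := eq_of_dim_le_one hd
      · rw [h.after_channel, ← mem_range_iff, hW.init, isInitialEl_channel_iff,
          isInitialEl_channel_iff]
        constructor
        · rintro (hx | hx) d ν hν ha
          · exact hx d _ ((h.isCore_ap_iff ν).2 hν) ((creates_ap_iff i ν x).2 ha)
          · exact hne (hW.linear.1.eq_of_creates ((h.isCore_ap_iff ν).2 hν) h.core
              ((creates_ap_iff i ν x).2 ha) hx)
        · intro hx
          by_contra! hx'
          obtain ⟨⟨d, ν, hν, ha⟩, hμ⟩ := hx'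
          obtain ⟨rfl, rfl⟩ | ⟨y, hy, rfl⟩ := h.core_cases ν hν
          · exact hμ ha
          · exact hx d y hy ((creates_ap_iff i y x).1 ha)
      · rw [h.after_agent, ← mem_range_iff, hW.init, isInitialEl_agent_iff, isInitialEl_agent_iff]
        constructor
        · rintro (hx | hx) d ν hν
          · exact hx d _ ((isSource_ap_iff i ν x).2 hν)
          · obtain ⟨e, f, y, hy, -, hν'⟩ := hν.exists_core
            exact hne (hW.linear.1.eq_of_isSource ((h.isCore_ap_iff y).2 hy) h.core
              ((isSource_ap_iff i y x).2 hν') hx)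
        · intro hx
          by_contra! hx'
          obtain ⟨⟨d, ν, ha⟩, hμ⟩ := hx'
          obtain ⟨y, rfl⟩ | ⟨f, rfl⟩ := h.mem_or_eq_res ν
          · exact hx d y ((isSource_ap_iff i y x).1 ha)
          · exact hμ ha.of_res
    · exact ⟨fun hx => absurd (hdim (.inl hx)) hd, fun hx => absurd (hdim (.inr hx)) hd⟩
  final := by
    have := h.mono
    intro d x
    rw [mem_range_iff]
    have h1 : (∃ u, ap s u = x) ↔ ∃ u, ap (s ≫ i) u = ap i x :=
      exists_congr fun u => ⟨congrArg _, ap_injective i⟩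
    rw [h1, ← mem_range_iff, hW.final, h.isFinalEl_iff]
    exact ⟨fun ⟨y, hy, e⟩ => ap_injective i e ▸ hy, fun hx => ⟨x, hx, rfl⟩⟩
  linear := by
    have hcore : ∀ {v : Vertex A}, v.IsCoreVertex → (h.vertex v).IsCoreVertex := by
      rintro (_ | _ | _) hv <;> exact hv
    have hagent : ∀ {v : Vertex A}, v.IsAgentVertex → (h.vertex v).IsAgentVertex := by
      rintro (_ | _ | _) hv <;> exact hv
    exact ⟨fun μ μ' x hμ hμ' e e' => h.vertex_injective (hW.linear.1 _ _ _ (hcore hμ) (hcore hμ')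
      (h.vertex_adj e) (h.vertex_adj e')),
      fun μ μ' x hμ hμ' hx e e' => h.vertex_injective (hW.linear.2 _ _ _ (hcore hμ) (hcore hμ')
      (hagent hx) (h.vertex_adj e) (h.vertex_adj e'))⟩
  wf := Subrelation.wf (fun {v w} (e : Later A v w) => (h.vertex_adj e : Later W _ _))
    (InvImage.wf h.vertex hW.wf)

end Step

/-! ### Traces are correct -/

theorem IsInterface.not_isSpent {d c : Base} {f : d ⟶ c} (h : IsInterface f) : ¬ IsSpent f := by
  obtain ⟨rfl, -⟩ := h
  exact not_isSpent_star f

/-- An action in terms of elements: `M` consists of the elements below `μ` and of the position `P`,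
which meet along the interface; the final and the initial position are the union of `P` with the
corresponding position of the seed. -/
structure ActionSpec {Y M X P : Psh} (s : Y ⟶ M) (t : X ⟶ M) {c : Base} (μ : El M c)
    (p : P ⟶ M) : Prop where
  one_lt_dim : 1 < dim c
  mono_s : Mono s
  mono_t : Mono t
  dim_P : ∀ {d : Base}, El P d → dim d ≤ 1
  inj : ∀ {d : Base} (f g : d ⟶ c), res M f μ = res M g μ → f = g ∨ IsInterface f ∧ IsInterface g
  inter : ∀ {d : Base} (f : d ⟶ c) (z : El P d), res M f μ = ap p z → IsInterface f
  cover : ∀ {d : Base} (x : El M d), (∃ f : d ⟶ c, x = res M f μ) ∨ ∃ z, ap p z = x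
  range_s : ∀ {d : Base} (x : El M d),
    (∃ u, ap s u = x) ↔ (∃ z, ap p z = x) ∨ ∃ f : d ⟶ c, ¬ IsSpent f ∧ x = res M f μ
  range_t : ∀ {d : Base} (x : El M d), (∃ u, ap t u = x) ↔ (∃ z, ap p z = x) ∨
    ∃ f : d ⟶ c, (IsInterface f ∨ dim d = 1 ∧ IsSpent f) ∧ x = res M f μ

/-- The leg of a pushed-out cospan inherits injectivity from that of the original one. -/
theorem mono_of_isPushout {I S T P Q M : Psh} {j : I ⟶ S} {h : I ⟶ P} {y : S ⟶ Q} {p : P ⟶ Q}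
    {s : S ⟶ T} {m : T ⟶ M} {q : P ⟶ M} {s' : Q ⟶ M} [Mono s] [Mono (j ≫ s)]
    (h1 : IsPushout j h y p) (h2 : IsPushout (j ≫ s) h m q) (e1 : y ≫ s' = s ≫ m)
    (e2 : p ≫ s' = q) : Mono s' := by
  have hq := mono_inr_of_isPushout h2
  -- Elements of the two summands with the same image come from the interface.
  have key : ∀ {d : Base} (a : El S d) (b : El P d), ap s' (ap y a) = ap s' (ap p b) →
      ap y a = ap p b := by
    intro d a b e
    rw [← ap_comp, ← ap_comp, e1, e2, ap_comp] at e
    obtain ⟨i, hi, rfl⟩ := ap_eq_of_isPushout h2 e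
    rw [ap_comp] at hi
    rw [← ap_injective s hi]
    exact ap_comm_of_isPushout h1 i
  rw [mono_iff_ap]
  intro d u v e
  obtain ⟨a, rfl⟩ | ⟨a, rfl⟩ := ap_cover_of_isPushout h1 u <;>
  obtain ⟨b, rfl⟩ | ⟨b, rfl⟩ := ap_cover_of_isPushout h1 v
  · have e' := e
    rw [← ap_comp, ← ap_comp, e1, ap_comp, ap_comp] at e'
    rcases ap_inl_eq_of_isPushout h2 e' with h | ⟨i, -, hi, -⟩
    · rw [ap_injective s h]
    · rw [ap_comp] at hi
      obtain rfl := ap_injective s hi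
      rw [ap_comm_of_isPushout h1] at e ⊢
      exact (key _ _ e.symm).symm
  · exact key a b e
  · exact (key b a e.symm).symm
  · rw [← ap_comp, ← ap_comp, e2] at e
    rw [ap_injective q e]

theorem IsAction.exists_spec {Y M X : Psh} {s : Y ⟶ M} {t : X ⟶ M} (h : IsAction s t) :
    ∃ (P : Psh) (c : Base) (μ : El M c) (p : P ⟶ M), ActionSpec s t μ p := by
  obtain ⟨Y₀, X₀, c, s₀, t₀, j, P, h, y, zy, m, zm, x, zx, hst, hj, hP, -, h1, h2, h3,
    e1, e2, e3, e4⟩ := h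
  have sp := hst.spec
  have := sp.mono_s
  have := sp.mono_t
  have := sp.mono_interface
  have : Mono (j ≫ s₀) := by rw [hj]; infer_instance
  have h2' : IsPushout (j ≫ s₀) h m zm := by rwa [hj]
  have hm : ∀ {d : Base} (f : d ⟶ c),
      ap m (f : El (rep c) d) = res M f (ap m (𝟙 c : El (rep c) c)) :=
    fun f => ap_eq_res m f
  refine ⟨P, c, ap m (𝟙 c : El (rep c) c), zm, ?_⟩
  exact {
    one_lt_dim := sp.one_lt_dim
    mono_s := mono_of_isPushout h1 h2' e1 e2
    mono_t := mono_of_isPushout h3 h2 e3 e4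
    dim_P := fun {d} z => not_lt.1 fun hd => (hP.2 d hd).false z
    inj := by
      intro d f g e
      rw [← hm, ← hm] at e
      rcases ap_inl_eq_of_isPushout h2 e with h | ⟨i, i', hi, hi'⟩
      · exact .inl h
      · exact .inr ⟨(sp.exists_interface_iff f).1 ⟨i, hi⟩, (sp.exists_interface_iff g).1 ⟨i', hi'⟩⟩
    inter := by
      intro d f z e
      rw [← hm] at e
      obtain ⟨i, hi, -⟩ := ap_eq_of_isPushout h2 e
      exact (sp.exists_interface_iff f).1 ⟨i, hi⟩
    cover := by
      intro d r
      obtain ⟨f, hf⟩ | hz := ap_cover_of_isPushout h2 r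
      · exact .inl ⟨f, by rw [← hf, hm]⟩
      · exact .inr hz
    range_s := by
      intro d r
      constructor
      · rintro ⟨u, rfl⟩
        obtain ⟨u, rfl⟩ | ⟨z, rfl⟩ := ap_cover_of_isPushout h1 u
        · refine .inr ⟨ap s₀ u, (sp.exists_s_iff _).1 ⟨u, rfl⟩, ?_⟩
          rw [← hm, ← ap_comp, e1, ap_comp]
        · exact .inl ⟨z, by rw [← ap_comp, e2]⟩
      · rintro (⟨z, rfl⟩ | ⟨f, hf, rfl⟩)
        · exact ⟨ap zy z, by rw [← ap_comp, e2]⟩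
        · obtain ⟨u, rfl⟩ := (sp.exists_s_iff f).2 hf
          refine ⟨ap y u, ?_⟩
          rw [← hm, ← ap_comp, e1, ap_comp]
    range_t := by
      intro d r
      constructor
      · rintro ⟨u, rfl⟩
        obtain ⟨u, rfl⟩ | ⟨z, rfl⟩ := ap_cover_of_isPushout h3 u
        · refine .inr ⟨ap t₀ u, (sp.exists_t_iff _).1 ⟨u, rfl⟩, ?_⟩
          rw [← hm, ← ap_comp, e3, ap_comp]
        · exact .inl ⟨z, by rw [← ap_comp, e4]⟩
      · rintro (⟨z, rfl⟩ | ⟨f, hf, rfl⟩)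
        · exact ⟨ap zx z, by rw [← ap_comp, e4]⟩
        · obtain ⟨u, rfl⟩ := (sp.exists_t_iff f).2 hf
          refine ⟨ap x u, ?_⟩
          rw [← hm, ← ap_comp, e3, ap_comp] }

/-- Composing with a first action amounts to a step. -/
theorem ActionSpec.step {Z M X P A W : Psh} {s : Z ⟶ M} {t : X ⟶ M} {c : Base} {μ : El M c}
    {p : P ⟶ M} (h : ActionSpec s t μ p) {z : Z ⟶ A} [Mono z] {i : A ⟶ W} {j : M ⟶ W}
    (hW : IsPushout z s i j) : Step i (ap j μ) z (t ≫ j) := by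
  have := h.mono_s
  have hi : Mono i := mono_inr_of_isPushout hW.flip
  have hj : Mono j := mono_inr_of_isPushout hW
  have hrange : ∀ {d : Base} (x : El W d),
      (∃ y, ap i y = x) ↔ ¬ ∃ f : d ⟶ c, IsSpent f ∧ x = res W f (ap j μ) := by
    intro d x
    constructor
    · rintro ⟨y, rfl⟩ ⟨f, hf, e⟩
      rw [← ap_res] at e
      obtain ⟨u, -, hu⟩ := ap_eq_of_isPushout hW e
      rcases (h.range_s _).1 ⟨u, hu⟩ with ⟨v, hv⟩ | ⟨g, hg, e'⟩
      · exact (h.inter f v hv.symm).not_isSpent hf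
      · rcases h.inj f g e' with rfl | ⟨hf', -⟩
        · exact hg hf
        · exact hf'.not_isSpent hf
    · intro hx
      obtain hy | ⟨r, rfl⟩ := ap_cover_of_isPushout hW x
      · exact hy
      · have : ∃ u, ap s u = r := by
          rw [h.range_s]
          rcases h.cover r with ⟨f, rfl⟩ | hv
          · exact .inr ⟨f, fun hf => hx ⟨f, hf, ap_res j f μ⟩, rfl⟩
          · exact .inl hv
        obtain ⟨u, rfl⟩ := this
        exact ⟨ap z u, ap_comm_of_isPushout hW u⟩
  exact {
    mono := hi
    core := by
      refine ⟨h.one_lt_dim, fun d f y hd e => ?_⟩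
      obtain ⟨a, rfl⟩ | ⟨r, rfl⟩ := ap_cover_of_isPushout hW y
      · rw [← ap_res] at e
        refine (hrange _).1 ⟨_, e⟩ ⟨𝟙 c, .inl h.one_lt_dim, (res_id W _).symm⟩
      · rcases h.cover r with ⟨g, -⟩ | ⟨v, -⟩
        · exact absurd (dim_le_of_hom g) (not_le.2 hd)
        · exact absurd (h.dim_P v) (not_le.2 (h.one_lt_dim.trans hd))
    inj := by
      intro d f g e
      rw [← ap_res, ← ap_res] at e
      exact h.inj f g (ap_injective j e)
    range := hrange
    dim_X := by
      intro d u
      rcases (h.range_t _).1 ⟨u, rfl⟩ with ⟨v, -⟩ | ⟨f, hf | ⟨hd, -⟩, -⟩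
      · exact h.dim_P v
      · exact hf.dim_eq.le.trans zero_le_one
      · exact hd.le
    before := by
      intro d f
      have : (∃ u, ap (t ≫ j) u = res W f (ap j μ)) ↔ ∃ u, ap t u = res M f μ := by
        rw [← ap_res]
        exact exists_congr fun u => ⟨ap_injective j, congrArg _⟩
      rw [this, h.range_t]
      constructor
      · rintro (⟨v, hv⟩ | ⟨g, hg, e⟩)
        · exact .inl (h.inter f v hv.symm)
        · rcases h.inj f g e with rfl | ⟨hf, -⟩
          · exact hg
          · exact .inl hf
      · exact fun hf => .inr ⟨f, hf, rfl⟩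
    after := by
      intro d y
      constructor
      · rintro ⟨u, rfl⟩
        rcases (h.range_s _).1 ⟨u, rfl⟩ with hv | ⟨f, hf, e⟩
        · obtain ⟨v, hv⟩ := (h.range_t _).2 (.inl hv)
          exact .inl ⟨v, by rw [ap_comp, hv, ap_comm_of_isPushout hW]⟩
        · exact .inr ⟨f, hf, by rw [ap_comm_of_isPushout hW, e, ap_res]⟩
      · rintro (⟨u, hu⟩ | ⟨f, hf, e⟩)
        · obtain ⟨v, hv, -⟩ := ap_eq_of_isPushout hW hu.symm
          exact ⟨v, hv⟩
        · rw [← ap_res] at e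
          obtain ⟨v, hv, -⟩ := ap_eq_of_isPushout hW e
          exact ⟨v, hv⟩ }

theorem isInitialEl_of_position {U : Psh} (hU : ∀ c : Base, 1 < dim c → IsEmpty (El U c))
    {d : Base} (x : El U d) : IsInitialEl U x := by
  have hd : dim d ≤ 1 := not_lt.1 fun hd => (hU d hd).false x
  obtain rfl | ⟨k, rfl⟩ := eq_of_dim_le_one hd
  · exact (isInitialEl_channel_iff x).2 fun c ν hν => ((hU c hν.1).false ν).elim
  · exact (isInitialEl_agent_iff x).2 fun c ν hν => (hU c hν.one_lt_dim).false ν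

theorem isFinalEl_of_position {U : Psh} (hU : ∀ c : Base, 1 < dim c → IsEmpty (El U c))
    {d : Base} (x : El U d) : IsFinalEl U x := by
  have hd : dim d ≤ 1 := not_lt.1 fun hd => (hU d hd).false x
  obtain rfl | ⟨k, rfl⟩ := eq_of_dim_le_one hd
  · exact .channel x
  · exact (isFinalEl_agent_iff x).2 fun c ν hν => (hU c hν.one_lt_dim).false ν

/-- A presheaf without elements of dimension at least two is correct with respect to surjective
legs. -/
theorem isCorrect_of_position {Y U X : Psh} {s : Y ⟶ U} {t : X ⟶ U}
    (hU : ∀ c : Base, 1 < dim c → IsEmpty (El U c))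
    (hs : ∀ (d : Base) (x : El U d), ∃ u, ap s u = x)
    (ht : ∀ (d : Base) (x : El U d), ∃ u, ap t u = x) : IsCorrect s t where
  loc := locallyOneInjective_iff.2 fun c μ hμ => ((hU c hμ.1).false μ).elim
  init d x := ⟨fun _ => isInitialEl_of_position hU x, fun _ => ht d x⟩
  final d x := ⟨fun _ => isFinalEl_of_position hU x, fun _ => hs d x⟩
  linear := linear_of (fun {c _} μ _ hμ => ((hU c hμ.1).false μ).elim)
    (fun {c _} μ _ hμ => ((hU c hμ.1).false μ).elim)
    (fun {c _} μ _ hμ => ((hU c hμ.1).false μ).elim)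
  wf := by
    have hc : ∀ a : Channel U, Acc (Later U) (.channel a) := by
      refine fun a => ⟨_, fun w e => ?_⟩
      change CausalAdj U _ _ at e
      cases e with
      | created c μ hμ => exact ((hU c hμ.1).false μ).elim
    refine ⟨fun v => ⟨_, fun w e => ?_⟩⟩
    change CausalAdj U _ _ at e
    cases e with
    | agent_channel => exact hc _
    | source c μ hμ => exact ((hU c hμ.1).false μ).elim
    | created c μ hμ => exact ((hU c hμ.1).false μ).elim
    | target c μ hμ => exact ((hU c hμ.1).false μ).elim

/-- Correctness depends on the legs of a cospan through their images only. -/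
theorem IsCorrect.of_range {Y Y' U X X' : Psh} {s : Y ⟶ U} {t : X ⟶ U} {s' : Y' ⟶ U} {t' : X' ⟶ U}
    (h : IsCorrect s t)
    (hs : ∀ (d : Base) (x : El U d), (∃ u, ap s' u = x) ↔ ∃ u, ap s u = x)
    (ht : ∀ (d : Base) (x : El U d), (∃ u, ap t' u = x) ↔ ∃ u, ap t u = x) : IsCorrect s' t' where
  loc := h.loc
  init d x := (ht d x).trans (h.init d x)
  final d x := (hs d x).trans (h.final d x)
  linear := h.linear
  wf := h.wf

theorem exists_ap_iso {U V : Psh} (e : U ≅ V) (d : Base) (x : El V d) :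
    ∃ u, ap e.hom u = x :=
  ⟨ap e.inv x, by rw [← ap_comp, e.inv_hom_id, ap_id]⟩

theorem exists_ap_iso_comp_iff {Y Y' U : Psh} (e : Y ≅ Y') (s : Y' ⟶ U) {d : Base} (x : El U d) :
    (∃ u, ap (e.hom ≫ s) u = x) ↔ ∃ u, ap s u = x := by
  constructor
  · rintro ⟨u, rfl⟩
    exact ⟨_, rfl⟩
  · rintro ⟨u, rfl⟩
    obtain ⟨v, rfl⟩ := exists_ap_iso e d u
    exact ⟨v, rfl⟩

theorem IsComposite.mono {Y U X : Psh} {s : Y ⟶ U} {t : X ⟶ U} (h : IsComposite s t) :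
    Mono s ∧ Mono t := by
  induction h with
  | id hX => exact ⟨inferInstance, inferInstance⟩
  | comp s₂ t₂ s₁ t₁ i j h₂ h₁ hW ih =>
    obtain ⟨_, _⟩ := ih
    obtain ⟨P, c, μ, p, sp⟩ := h₁.exists_spec
    have := sp.mono_s
    have := sp.mono_t
    have : Mono i := mono_inr_of_isPushout hW.flip
    have : Mono j := mono_inr_of_isPushout hW
    exact ⟨mono_comp _ _, mono_comp _ _⟩

/-- The induction is over cospans isomorphic to a given composite: the isomorphism on `U` is
absorbed into the last pushout, the others do not affect the images of the legs. -/
theorem IsComposite.isCorrect {Y' U' X' : Psh} {s' : Y' ⟶ U'} {t' : X' ⟶ U'}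
    (h : IsComposite s' t') : ∀ {Y U X : Psh} (s : Y ⟶ U) (t : X ⟶ U)
      (eY : Y ≅ Y') (eU : U ≅ U') (eX : X ≅ X'), s ≫ eU.hom = eY.hom ≫ s' →
      t ≫ eU.hom = eX.hom ≫ t' → IsCorrect s t := by
  induction h with
  | id hP =>
    intro Y U X s t eY eU eX h1 h2
    have hs : s = (eY ≪≫ eU.symm).hom := by
      rw [← cancel_mono eU.hom, h1]
      simp
    have ht : t = (eX ≪≫ eU.symm).hom := by
      rw [← cancel_mono eU.hom, h2]
      simp
    refine isCorrect_of_position (fun c hc => ⟨fun x => (hP.2 c hc).false (ap eU.hom x)⟩) ?_ ?_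
    · rw [hs]
      exact exists_ap_iso _
    · rw [ht]
      exact exists_ap_iso _
  | comp s₂ t₂ s₁ t₁ i j h₂ h₁ hW ih =>
    intro Y U X s t eY eU eX h1 h2
    obtain ⟨P, c, μ, p, sp⟩ := h₁.exists_spec
    have := h₂.mono.2
    have hW' : IsPushout t₂ s₁ (i ≫ eU.inv) (j ≫ eU.inv) :=
      hW.of_iso (Iso.refl _) (Iso.refl _) (Iso.refl _) eU.symm (by simp) (by simp) (by simp)
        (by simp)
    have hA := ih s₂ t₂ (Iso.refl _) (Iso.refl _) (Iso.refl _) (by simp) (by simp)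
    have hs : s = eY.hom ≫ s₂ ≫ i ≫ eU.inv := by
      rw [← cancel_mono eU.hom, h1]
      simp
    have ht : t = eX.hom ≫ t₁ ≫ j ≫ eU.inv := by
      rw [← cancel_mono eU.hom, h2]
      simp
    refine ((sp.step hW').isCorrect_comp hA).of_range (fun d x => ?_) (fun d x => ?_)
    · rw [hs, exists_ap_iso_comp_iff]
    · rw [ht, exists_ap_iso_comp_iff]

theorem IsTrace.isCorrect {Y U X : Psh} {s : Y ⟶ U} {t : X ⟶ U} (h : IsTrace s t) :
    IsCorrect s t := by
  obtain ⟨Y', U', X', s', t', eY, eU, eX, h, h1, h2⟩ := h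
  exact h.isCorrect s t eY eU eX h1 h2

/-! ### Correct cospans are traces -/

/-- Actions may be transported along an isomorphism of final positions. -/
theorem IsAction.of_iso_final {Y Y' M X : Psh} {s : Y ⟶ M} {t : X ⟶ M} (h : IsAction s t)
    (e : Y' ≅ Y) : IsAction (e.hom ≫ s) t := by
  obtain ⟨Y₀, X₀, c, s₀, t₀, j, P, h, y, zy, m, zm, x, zx, hst, hj, hP, hh, h1, h2, h3,
    e1, e2, e3, e4⟩ := h
  refine ⟨Y₀, X₀, c, s₀, t₀, j, P, h, y ≫ e.inv, zy ≫ e.inv, m, zm, x, zx, hst, hj, hP, hh, ?_,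
    h2, h3, by simp [e1], by simp [e2], e3, e4⟩
  exact h1.of_iso (Iso.refl _) (Iso.refl _) (Iso.refl _) e.symm (by simp) (by simp) (by simp)
    (by simp)

/-- Composing a trace with a first action yields a trace. -/
theorem IsTrace.comp {Y A Z M X W : Psh} {s₂ : Y ⟶ A} {t₂ : Z ⟶ A} {s₁ : Z ⟶ M} {t₁ : X ⟶ M}
    {i : A ⟶ W} {j : M ⟶ W} (h₂ : IsTrace s₂ t₂) (h₁ : IsAction s₁ t₁)
    (hW : IsPushout t₂ s₁ i j) : IsTrace (s₂ ≫ i) (t₁ ≫ j) := by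
  obtain ⟨Y', A', Z', s', t', eY, eA, eZ, h, e1, e2⟩ := h₂
  refine ⟨Y', W, X, s' ≫ eA.inv ≫ i, t₁ ≫ j, eY, Iso.refl _, Iso.refl _,
    .comp s' t' (eZ.symm.hom ≫ s₁) t₁ (eA.inv ≫ i) j h (h₁.of_iso_final eZ.symm) ?_, ?_, by simp⟩
  · exact hW.of_iso eZ eA (Iso.refl _) (Iso.refl _) e2 (by simp) (by simp) (by simp)
  · rw [← reassoc_of% e1]
    simp

/-- If there are no actions, both legs of a correct cospan are isomorphisms. -/
theorem isTrace_of_position {Y U X : Psh} {s : Y ⟶ U} {t : X ⟶ U} [Mono s] [Mono t]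
    (hfin : IsFinite U) (hU : ∀ c : Base, 1 < dim c → IsEmpty (El U c)) (h : IsCorrect s t) :
    IsTrace s t := by
  have : IsIso s := isIso_of_ap s fun d x => (h.final d x).2 (isFinalEl_of_position hU x)
  have : IsIso t := isIso_of_ap t fun d x => (h.init d x).2 (isInitialEl_of_position hU x)
  exact ⟨U, U, U, 𝟙 U, 𝟙 U, asIso s, Iso.refl U, asIso t, .id U ⟨hfin, hU⟩, by simp, by simp⟩

theorem sigma_ap_injective {A W : Psh} (i : A ⟶ W) [Mono i] : Function.Injective
    (fun x : Σ c : Base, El A c => (⟨x.1, ap i x.2⟩ : Σ c : Base, El W c)) := by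
  rintro ⟨d, x⟩ ⟨e, y⟩ hxy
  injection hxy with h1 h2
  obtain rfl : d = e := h1
  obtain rfl : x = y := ap_injective i (eq_of_heq h2)
  rfl

theorem IsFinite.of_mono {A W : Psh} (i : A ⟶ W) [Mono i] (h : IsFinite W) : IsFinite A :=
  have : Finite (Σ c : Base, El W c) := h
  Finite.of_injective _ (sigma_ap_injective i)

theorem card_lt_of_mono {A W : Psh} (i : A ⟶ W) [Mono i] (h : IsFinite W) {c : Base} {x : El W c}
    (hx : ¬ ∃ y, ap i y = x) : Nat.card (Σ c : Base, El A c) < Nat.card (Σ c : Base, El W c) := by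
  have : Finite (Σ c : Base, El W c) := h
  have := Fintype.ofFinite (Σ c : Base, El W c)
  have : Finite (Σ c : Base, El A c) := IsFinite.of_mono i h
  have := Fintype.ofFinite (Σ c : Base, El A c)
  rw [Nat.card_eq_fintype_card, Nat.card_eq_fintype_card]
  refine Fintype.card_lt_of_injective_of_notMem _ (sigma_ap_injective i) (b := ⟨c, x⟩) ?_
  rintro ⟨⟨d, y⟩, e⟩
  injection e with h1 h2
  subst h1
  exact hx ⟨y, eq_of_heq h2⟩

section FirstAction

variable {Y W X : Psh} {s : Y ⟶ W} {t : X ⟶ W} (hW : IsCorrect s t) {c : Base} {μ : El W c}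
  (hμ : IsCore W μ)

/-- `μ` is an earliest core: no path of the causal graph leads from `μ` to a core. -/
def IsFirst {W : Psh} {c : Base} {μ : El W c} (hμ : IsCore W μ) : Prop :=
  ∀ v : Vertex W, v.IsCoreVertex → ¬ Relation.TransGen (Later W) v (.core c μ hμ)

theorem exists_isFirst (hwf : WellFounded (Later W)) {d : Base} {ν : El W d} (hν : IsCore W ν) :
    ∃ (c : Base) (μ : El W c) (hμ : IsCore W μ), IsFirst hμ := by
  obtain ⟨v, hv, hmin⟩ := hwf.transGen.has_min {v : Vertex W | v.IsCoreVertex}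
    ⟨.core d ν hν, trivial⟩
  rcases v with _ | _ | ⟨c, μ, hμ⟩
  · exact hv.elim
  · exact hv.elim
  · exact ⟨c, μ, hμ, hmin⟩

variable (hfirst : IsFirst hμ)

include hfirst in
/-- The targets of a first core are initial. -/
theorem IsFirst.not_isSource {x : Agent W} (hx : IsTarget W μ x) {d : Base} (ν : El W d) :
    ¬ IsSource W ν x := by
  intro hν
  obtain ⟨e, -, ν', hν', -, hs⟩ := hν.exists_core
  refine hfirst (.core e ν' hν') trivial ?_
  exact .tail (.single (CausalAdj.source e ν' hν' x hs)) (CausalAdj.target c μ hμ x hx)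

include hfirst in
/-- The channels of the targets of a first core are initial. -/
theorem IsFirst.not_creates {k : ℕ} {x : El W (ob (.agent k))} (hx : IsTarget W μ ⟨k, x⟩)
    (j : Fin k) {d : Base} (ν : El W d) (hν : IsCore W ν) :
    ¬ Creates W ν (res W (arr (.chan k j)) x) := by
  intro ha
  refine hfirst (.core d ν hν) trivial ?_
  exact .tail (.tail (.single (CausalAdj.created d ν hν _ ha)) (CausalAdj.agent_channel k x j))
    (CausalAdj.target c μ hμ _ hx)

include hW hfirst in
/-- Below a first core, the initial position consists of the interface and the targets. -/
theorem IsFirst.exists_t_iff {d : Base} (f : d ⟶ c) :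
    (∃ u, ap t u = res W f μ) ↔ IsInterface f ∨ dim d = 1 ∧ IsSpent f := by
  obtain ⟨Y₀, X₀, s₀, t₀, hst⟩ := exists_isSeed hμ.1
  have sp := hst.spec
  constructor
  · intro h
    have hi := (hW.init _ _).1 h
    obtain rfl | ⟨k, rfl⟩ := eq_of_dim_le_one (isInitialEl_dim hi)
    · rw [isInitialEl_channel_iff] at hi
      exact .inl ((isInterface_star f).2 fun hf => hi c μ hμ ((creates_iff _ _).2 ⟨f, hf, rfl⟩))
    · rw [isInitialEl_agent_iff] at hi
      refine .inr ⟨rfl, (isSpent_agent f).2 ((isSrc_or_isTgt hμ.1 f).resolve_left fun hf => ?_)⟩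
      exact hi c μ ((isSource_iff_exists_isSrc _ _ _).2 ⟨f, hf, rfl⟩)
  · intro h
    refine (hW.init _ _).2 ?_
    rcases h with hf | ⟨hd, hf⟩
    · obtain rfl := eq_star_of_dim hf.dim_eq
      obtain ⟨u, rfl⟩ := (sp.star_t f).2 ((isInterface_star f).1 hf)
      obtain ⟨k, j, v, rfl⟩ := sp.star_agent u
      have hv : IsTarget W μ ⟨k, res W (ap t₀ v : ob (.agent k) ⟶ c) μ⟩ :=
        (isTarget_iff_exists_isTgt _ _ _).2 ⟨_, (sp.agent_t _).1 ⟨v, rfl⟩, rfl⟩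
      rw [isInitialEl_channel_iff, ap_res, res_rep, ← res_res]
      exact fun d ν hν => hfirst.not_creates hμ hv j ν hν
    · obtain ⟨k, rfl⟩ := eq_agent_of_dim hd
      rw [isInitialEl_agent_iff]
      refine fun d ν => hfirst.not_isSource hμ ?_ ν
      exact (isTarget_iff_exists_isTgt _ _ _).2 ⟨f, (isSpent_agent f).1 hf, rfl⟩

omit hW in
/-- An element whose core shares a source or a target with `μ` lies below `μ`. -/
theorem exists_res_of_core_eq {d e : Base} {g : d ⟶ e} {ν : El W e} {hν : IsCore W ν}
    (h : Vertex.core e ν hν = Vertex.core c μ hμ) : ∃ f : d ⟶ c, res W g ν = res W f μ := by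
  injection h with h1 h2
  subst h1
  obtain rfl := eq_of_heq h2
  exact ⟨g, rfl⟩

include hW hfirst in
/-- If a restriction of `y` is consumed by the first core `μ`, then so is `y`. -/
theorem IsFirst.exists_spent {d e : Base} (g : d ⟶ e) (y : El W e)
    (h : ∃ f : d ⟶ c, IsSpent f ∧ res W g y = res W f μ) :
    ∃ f : e ⟶ c, IsSpent f ∧ y = res W f μ := by
  obtain ⟨f, hf, hfy⟩ := h
  obtain ⟨rfl, rfl⟩ | hlt := eq_or_dim_lt g
  · exact ⟨f, hf, by rwa [eqToHom_refl, res_id] at hfy⟩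
  have hd : 1 ≤ dim d := by
    rcases hf with hd | ⟨k, rfl, -⟩
    · exact hd.le
    · exact le_rfl
  have he : 1 < dim e := hd.trans_lt hlt
  suffices ∃ f : e ⟶ c, y = res W f μ by
    obtain ⟨f, hf⟩ := this
    exact ⟨f, .inl he, hf⟩
  have hsrc : ∀ {x : Agent W}, IsSource W y x → IsSource W μ x → ∃ f : e ⟶ c, y = res W f μ := by
    intro x h1 h2
    obtain ⟨e', k, y', hy', rfl, h1'⟩ := h1.exists_core
    exact exists_res_of_core_eq hμ (hW.linear.1.eq_of_isSource hy' hμ h1' h2)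
  by_cases hd' : 1 < dim d
  · -- Any source of an action element below both `y` and `μ` is a source of their cores.
    obtain ⟨v, ⟨k⟩⟩ := exists_act_hom hd'
    have hx : IsSource W (res W g y) ⟨v.finalArity, res W (arr (.src v)) (res W k (res W g y))⟩ :=
      ⟨v, k, rfl⟩
    have hx' : IsSource W (res W f μ)
        ⟨v.finalArity, res W (arr (.src v)) (res W k (res W g y))⟩ := ⟨v, k, by rw [hfy]⟩
    exact hsrc hx.of_res hx'.of_res
  · obtain ⟨n, rfl⟩ := eq_agent_of_dim (le_antisymm (not_lt.1 hd') hd)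
    have hx : IsTarget W μ ⟨n, res W g y⟩ :=
      (isTarget_iff_exists_isTgt _ _ _).2 ⟨f, (isSpent_agent f).1 hf, hfy⟩
    rcases isSrc_or_isTgt he g with hg | hg
    · exact absurd ((isSource_iff_exists_isSrc _ _ _).2 ⟨g, hg, rfl⟩) (hfirst.not_isSource hμ hx y)
    · have hx' : IsTarget W y ⟨n, res W g y⟩ := (isTarget_iff_exists_isTgt _ _ _).2 ⟨g, hg, rfl⟩
      obtain ⟨e', k, y', hy', hk, h1'⟩ := hx'.exists_core
      rw [hk]
      exact exists_res_of_core_eq hμ (hW.linear.2.eq_of_isTarget hy' hμ h1' hx)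

/-- What remains of `W` after the action of a first core `μ`: all elements not consumed by `μ`. -/
def remainder : Subfunctor W where
  obj d := {x | ¬ ∃ f : d.unop ⟶ c, IsSpent f ∧ x = res W f μ}
  map g x hx h := hx (hfirst.exists_spent hW hμ g.unop x h)

/-- The elements of the action of `μ`: those below `μ`, and those of the initial position. -/
def firstAction (t : X ⟶ W) (μ : El W c) : Subfunctor W :=
  Subfunctor.range (yonedaEquiv.symm μ : rep c ⟶ W) ⊔ Subfunctor.range t

end FirstAction

theorem exists_ap_ι_iff {W : Psh} (G : Subfunctor W) {d : Base} (x : El W d) :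
    (∃ y, ap G.ι y = x) ↔ x ∈ G.obj (op d) :=
  ⟨fun ⟨y, hy⟩ => hy ▸ y.2, fun h => ⟨⟨x, h⟩, rfl⟩⟩

/-- A correct cospan with a core decomposes as a first action followed by the remainder. -/
theorem IsCorrect.exists_decomposition {Y W X : Psh} {s : Y ⟶ W} {t : X ⟶ W} [Mono t]
    (hW : IsCorrect s t) (hfin : IsFinite W) {c : Base} {μ : El W c} (hμ : IsCore W μ)
    (hfirst : IsFirst hμ) :
    ∃ (A Z M : Psh) (i : A ⟶ W) (j : M ⟶ W) (z : Z ⟶ A) (s₁ : Z ⟶ M) (t₁ : X ⟶ M),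
      Mono z ∧ IsAction s₁ t₁ ∧ IsPushout z s₁ i j ∧ t₁ ≫ j = t ∧ Step i μ z t := by
  obtain ⟨Y₀, X₀, s₀, t₀, hst⟩ := exists_isSeed hμ.1
  have sp := hst.spec
  have := sp.mono_s
  have := sp.mono_t
  have := sp.mono_interface
  have hbefore := fun {d : Base} (f : d ⟶ c) => hfirst.exists_t_iff hW hμ f
  have hinj := fun {d : Base} (f g : d ⟶ c) => locallyOneInjective_iff.1 hW.loc c μ hμ d f g
  have hdimX : ∀ {d : Base}, El X d → dim d ≤ 1 :=
    fun {d} u => isInitialEl_dim ((hW.init d _).1 ⟨u, rfl⟩)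
  -- The remainder `A` and the action `B` meet in the new initial position `Q`; the position `P`
  -- consists of the part of `X` not involved in the action.
  let A : Subfunctor W := remainder hW hμ hfirst
  let B : Subfunctor W := firstAction t μ
  let P : Subfunctor W := Subfunctor.range t ⊓ A
  let Q : Subfunctor W := A ⊓ B
  let m₀ : rep c ⟶ W := yonedaEquiv.symm μ
  have hA : ∀ {d : Base} (x : El W d),
      x ∈ A.obj (op d) ↔ ¬ ∃ f : d ⟶ c, IsSpent f ∧ x = res W f μ := fun x => Iff.rfl
  have hB : ∀ {d : Base} (x : El W d),
      x ∈ B.obj (op d) ↔ (∃ f : d ⟶ c, x = res W f μ) ∨ ∃ u, ap t u = x := by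
    intro d x
    refine or_congr_left (exists_congr fun f => eq_comm)
  have hP : ∀ {d : Base} (x : El W d),
      x ∈ P.obj (op d) ↔ (∃ u, ap t u = x) ∧ x ∈ A.obj (op d) := fun x => Iff.rfl
  have hQ : ∀ {d : Base} (x : El W d),
      x ∈ Q.obj (op d) ↔ x ∈ A.obj (op d) ∧ x ∈ B.obj (op d) := fun x => Iff.rfl
  have hresA : ∀ {d : Base} (f : d ⟶ c), res W f μ ∈ A.obj (op d) ↔ ¬ IsSpent f := by
    intro d f
    rw [hA]
    refine not_congr ⟨?_, fun hf => ⟨f, hf, rfl⟩⟩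
    rintro ⟨g, hg, e⟩
    rcases hinj f g e with rfl | ⟨-, hg'⟩
    · exact hg
    · exact absurd hg hg'.not_isSpent
  have hresP : ∀ {d : Base} (f : d ⟶ c), res W f μ ∈ P.obj (op d) ↔ IsInterface f := by
    intro d f
    rw [hP, hbefore, hresA]
    constructor
    · rintro ⟨hf | hf, hf'⟩
      · exact hf
      · exact absurd hf.2 hf'
    · exact fun hf => ⟨.inl hf, hf.not_isSpent⟩
  have hPA : P ≤ A := inf_le_right
  have hPB : P ≤ B := inf_le_left.trans le_sup_right
  have hPQ : P ≤ Q := le_inf hPA hPB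
  -- The morphisms of the diagrams, all of which commute with the maps to `W`.
  obtain ⟨j₀, hj₀⟩ := exists_lift (interfaceι X₀ ≫ t₀) s₀ fun d i =>
    (sp.exists_s_iff _).2 ((sp.exists_interface_iff _).1 ⟨i, rfl⟩).not_isSpent
  obtain ⟨h, hh⟩ := exists_lift ((interfaceι X₀ ≫ t₀) ≫ m₀) P.ι fun d i =>
    (exists_ap_ι_iff _ _).2 ((hresP _).2 ((sp.exists_interface_iff _).1 ⟨i, rfl⟩))
  obtain ⟨y, hy⟩ := exists_lift (s₀ ≫ m₀) Q.ι fun d u =>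
    (exists_ap_ι_iff _ _).2 ((hQ _).2 ⟨(hresA _).2 ((sp.exists_s_iff _).1 ⟨u, rfl⟩),
      (hB _).2 (.inl ⟨_, rfl⟩)⟩)
  obtain ⟨m, hm⟩ := exists_lift m₀ B.ι fun d f =>
    (exists_ap_ι_iff _ _).2 ((hB _).2 (.inl ⟨f, rfl⟩))
  obtain ⟨x, hx⟩ := exists_lift (t₀ ≫ m₀) t fun d u =>
    (hbefore _).2 ((sp.exists_t_iff _).1 ⟨u, rfl⟩)
  obtain ⟨px, hpx⟩ := exists_lift P.ι t fun d z => z.2.1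
  obtain ⟨t₁, ht₁⟩ := exists_lift t B.ι fun d u =>
    (exists_ap_ι_iff _ _).2 ((hB _).2 (.inr ⟨u, rfl⟩))
  have hpq : Subfunctor.homOfLe hPQ ≫ Q.ι = P.ι := rfl
  have hpb : Subfunctor.homOfLe hPB ≫ B.ι = P.ι := rfl
  have hqb : Subfunctor.homOfLe (inf_le_right : Q ≤ B) ≫ B.ι = Q.ι := rfl
  have hqa : Subfunctor.homOfLe (inf_le_left : Q ≤ A) ≫ A.ι = Q.ι := rfl
  have hy' : ∀ {d : Base} (u : El Y₀ d), (ap y u).1 = res W (ap s₀ u : d ⟶ c) μ :=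
    fun u => ap_congr hy u
  have hm' : ∀ {d : Base} (f : d ⟶ c), (ap m (f : El (rep c) d)).1 = res W f μ :=
    fun f => ap_congr hm (f : El (rep c) _)
  have hx' : ∀ {d : Base} (u : El X₀ d), ap t (ap x u) = res W (ap t₀ u : d ⟶ c) μ :=
    fun u => ap_congr hx u
  have hpx' : ∀ {d : Base} (z : El P.toFunctor d), ap t (ap px z) = z.1 := fun z => ap_congr hpx z
  have : Mono j₀ := by
    have : Mono (j₀ ≫ s₀) := by rw [hj₀]; infer_instance
    exact mono_of_mono j₀ s₀
  have : Mono px := by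
    have : Mono (px ≫ t) := by rw [hpx]; infer_instance
    exact mono_of_mono px t
  have : Mono (Subfunctor.homOfLe hPQ) := mono_of_mono (Subfunctor.homOfLe hPQ) Q.ι
  have : Mono (Subfunctor.homOfLe hPB) := mono_of_mono (Subfunctor.homOfLe hPB) B.ι
  -- `Q` is the final position of the seed, pushed out.
  have push₁ : IsPushout j₀ h y (Subfunctor.homOfLe hPQ) := by
    refine isPushout_of_ap ?_ ?_ ?_ ?_
    · rw [← cancel_mono Q.ι, Category.assoc, Category.assoc, hy, hpq, hh, ← hj₀, Category.assoc]
    · intro d u v e hu hv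
      have e' := congrArg Subtype.val e
      rw [hy', hy'] at e'
      rcases hinj _ _ e' with e' | ⟨hi, -⟩
      · exact ap_injective s₀ e'
      · obtain ⟨i, hi⟩ := (sp.exists_interface_iff _).2 hi
        rw [← hj₀] at hi
        exact absurd (ap_injective s₀ hi) (hu i)
    · intro d u z e
      have e' := congrArg Subtype.val e
      rw [hy'] at e'
      obtain ⟨i, hi⟩ := (sp.exists_interface_iff _).2 ((hresP _).1 (e' ▸ z.2))
      rw [← hj₀] at hi
      exact ⟨i, ap_injective s₀ hi⟩
    · rintro d ⟨r, hrA, hrB⟩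
      rcases (hB r).1 hrB with ⟨f, rfl⟩ | hr
      · obtain ⟨u, rfl⟩ := (sp.exists_s_iff f).2 ((hresA f).1 hrA)
        exact .inl ⟨u, Subtype.ext (hy' u)⟩
      · exact .inr ⟨⟨r, hr, hrA⟩, rfl⟩
  -- `B` is the seed itself, pushed out.
  have push₂ : IsPushout (interfaceι X₀ ≫ t₀) h m (Subfunctor.homOfLe hPB) := by
    refine isPushout_of_ap ?_ ?_ ?_ ?_
    · rw [← cancel_mono B.ι, Category.assoc, Category.assoc h, hm, hpb, hh]
    · intro d f g e hf hg
      have e' := congrArg Subtype.val e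
      rw [hm', hm'] at e'
      rcases hinj _ _ e' with e' | ⟨hi, -⟩
      · exact e'
      · obtain ⟨i, hi⟩ := (sp.exists_interface_iff _).2 hi
        exact absurd hi (hf i)
    · intro d f z e
      have e' := congrArg Subtype.val e
      rw [hm'] at e'
      exact (sp.exists_interface_iff _).2 ((hresP _).1 (e' ▸ z.2))
    · rintro d ⟨r, hrB⟩
      by_cases hrA : r ∈ A.obj (op d)
      · rcases (hB r).1 hrB with ⟨f, rfl⟩ | hr
        · exact .inl ⟨f, Subtype.ext (hm' f)⟩
        · exact .inr ⟨⟨r, hr, hrA⟩, rfl⟩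
      · obtain ⟨f, -, rfl⟩ := not_not.1 hrA
        exact .inl ⟨f, Subtype.ext (hm' f)⟩
  -- `X` is the initial position of the seed, pushed out.
  have push₃ : IsPushout (interfaceι X₀) h x px := by
    refine isPushout_of_ap ?_ ?_ ?_ ?_
    · rw [← cancel_mono t, Category.assoc, Category.assoc, hx, hpx, hh, Category.assoc]
    · intro d u v e hu hv
      have e' := congrArg (ap t) e
      rw [hx', hx'] at e'
      rcases hinj _ _ e' with e' | ⟨hi, -⟩
      · exact ap_injective t₀ e'
      · obtain ⟨i, hi⟩ := (sp.exists_interface_iff _).2 hi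
        exact absurd (ap_injective t₀ hi) (hu i)
    · intro d u z e
      have e' := congrArg (ap t) e
      rw [hx', hpx'] at e'
      obtain ⟨i, hi⟩ := (sp.exists_interface_iff _).2 ((hresP _).1 (e' ▸ z.2))
      exact ⟨i, ap_injective t₀ hi⟩
    · intro d r
      by_cases hr : ap t r ∈ A.obj (op d)
      · exact .inr ⟨⟨ap t r, ⟨r, rfl⟩, hr⟩, ap_injective t (hpx' _)⟩
      · obtain ⟨f, -, e⟩ := not_not.1 hr
        obtain ⟨u, rfl⟩ := (sp.exists_t_iff f).2 ((hbefore f).1 ⟨r, e⟩)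
        exact .inl ⟨u, ap_injective t ((hx' u).trans e.symm)⟩
  -- `W` is the composite of the remainder and the action.
  have : Mono (Subfunctor.homOfLe (inf_le_left : Q ≤ A)) := mono_of_mono _ A.ι
  have push₄ : IsPushout (Subfunctor.homOfLe (inf_le_left : Q ≤ A))
      (Subfunctor.homOfLe (inf_le_right : Q ≤ B)) A.ι B.ι := by
    refine isPushout_of_ap ?_ ?_ ?_ ?_
    · rw [hqa, hqb]
    · exact fun d a a' e _ _ => ap_injective A.ι e
    · intro d a b e
      refine ⟨⟨a.1, a.2, ?_⟩, rfl⟩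
      change a.1 = b.1 at e
      rw [e]
      exact b.2
    · intro d r
      by_cases hr : r ∈ A.obj (op d)
      · exact .inl ⟨⟨r, hr⟩, rfl⟩
      · obtain ⟨f, -, e⟩ := not_not.1 hr
        exact .inr ⟨⟨r, (hB r).2 (.inl ⟨f, e⟩)⟩, rfl⟩
  have hposP : IsPosition P.toFunctor :=
    ⟨hfin.of_mono P.ι, fun d hd => ⟨fun z => absurd (hdimX (ap px z)) (not_le.2 hd)⟩⟩
  have hone : OneInjective h := by
    intro d hd i
    have : dim d = 0 := i.2
    omega
  refine ⟨A.toFunctor, Q.toFunctor, B.toFunctor, A.ι, B.ι, Subfunctor.homOfLe inf_le_left,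
    Subfunctor.homOfLe inf_le_right, t₁, inferInstance, ?_, push₄, ht₁, ?_⟩
  · refine ⟨Y₀, X₀, c, s₀, t₀, j₀, P.toFunctor, h, y, _, m, _, x, px, hst, hj₀, hposP, hone,
      push₁, push₂, push₃, ?_, rfl, ?_, ?_⟩
    · rw [← cancel_mono B.ι, Category.assoc, hqb, hy, Category.assoc, hm]
    · rw [← cancel_mono B.ι, Category.assoc, ht₁, hx, Category.assoc, hm]
    · rw [← cancel_mono B.ι, Category.assoc, ht₁, hpx, hpb]
  · exact {
      mono := inferInstance
      core := hμ
      inj := hinj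
      range := fun r => (exists_ap_ι_iff A r).trans (hA r)
      dim_X := hdimX
      before := hbefore
      after := by
        intro d r
        constructor
        · rintro ⟨u, rfl⟩
          rcases (hB u.1).1 u.2.2 with ⟨f, e⟩ | hu
          · exact .inr ⟨f, (hresA f).1 (e ▸ u.2.1), e⟩
          · exact .inl hu
        · rintro (hu | ⟨f, -, e⟩)
          · exact ⟨⟨r.1, r.2, (hB _).2 (.inr hu)⟩, rfl⟩
          · exact ⟨⟨r.1, r.2, (hB _).2 (.inl ⟨f, e⟩)⟩, rfl⟩ }

/-- The vertices of the causal graph are elements of the presheaf. -/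
def Vertex.element {U : Psh} : Vertex U → Σ c : Base, El U c
  | .channel a => ⟨ob .star, a⟩
  | .agent x => ⟨ob (.agent x.1), x.2⟩
  | .core c μ _ => ⟨c, μ⟩

theorem Vertex.element_injective {U : Psh} : Function.Injective (Vertex.element (U := U)) := by
  intro v w e
  have hd : dim v.element.1 = dim w.element.1 := by rw [e]
  rcases v with a | ⟨k, x⟩ | ⟨c, μ, hμ⟩ <;> rcases w with b | ⟨l, y⟩ | ⟨d, ν, hν⟩
  case channel.channel =>
    injection e with h1 h2
    obtain rfl : a = b := h2
    rfl
  case agent.agent =>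
    injection e with h1 h2
    obtain rfl : k = l := ob_agent_injective h1
    obtain rfl : x = y := eq_of_heq h2
    rfl
  case core.core =>
    injection e with h1 h2
    subst h1
    obtain rfl := eq_of_heq h2
    rfl
  case channel.core => exact absurd hν.1 (hd ▸ by simp [Vertex.element])
  case core.channel => exact absurd hμ.1 (hd ▸ by simp [Vertex.element])
  case agent.core => exact absurd hν.1 (hd ▸ by simp [Vertex.element])
  case core.agent => exact absurd hμ.1 (hd ▸ by simp [Vertex.element])
  all_goals exact absurd hd (by simp [Vertex.element])

theorem wellFounded_later {U : Psh} (hU : IsFinite U) (h : Acyclic (causalGraph U)) :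
    WellFounded (Later U) := by
  have : Finite (Σ c : Base, El U c) := hU
  have : Finite (Vertex U) := Finite.of_injective _ Vertex.element_injective
  have : Std.Irrefl (Relation.TransGen (Later U)) :=
    ⟨fun v hv => h v (Relation.transGen_swap.1 hv)⟩
  have := Finite.wellFounded_of_trans_of_irrefl (Relation.TransGen (Later U))
  exact Subrelation.wf (fun {_ _} e => .single e) this

theorem acyclic_of_wellFounded_later {U : Psh} (h : WellFounded (Later U)) :
    Acyclic (causalGraph U) := fun v hv =>
  h.transGen.irrefl.irrefl v (Relation.transGen_swap.1 hv)

/-- Every correct cospan is a trace, by induction on the number of elements. -/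
theorem IsCorrect.isTrace {Y W X : Psh} {s : Y ⟶ W} {t : X ⟶ W} [Mono s] [Mono t]
    (hW : IsCorrect s t) (hfin : IsFinite W) : IsTrace s t := by
  generalize hn : Nat.card (Σ c : Base, El W c) = n
  induction n using Nat.strong_induction_on generalizing Y W X with
  | _ n ih =>
    by_cases hcore : ∃ (d : Base) (ν : El W d), IsCore W ν
    · obtain ⟨d, ν, hν⟩ := hcore
      obtain ⟨c, μ, hμ, hfirst⟩ := exists_isFirst hW.wf hν
      obtain ⟨A, Z, M, i, j, z, s₁, t₁, hz, hact, hpush, rfl, hstep⟩ :=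
        hW.exists_decomposition hfin hμ hfirst
      have := hstep.mono
      obtain ⟨s₂, rfl⟩ := exists_lift s i fun d u => by
        obtain ⟨y, -, hy⟩ := (hstep.isFinalEl_iff _).1 ((hW.final d _).1 ⟨u, rfl⟩)
        exact ⟨y, hy⟩
      have : Mono s₂ := mono_of_mono s₂ i
      have hcard := card_lt_of_mono i hfin (x := μ) fun ⟨y, hy⟩ => hstep.ap_ne_core y hy
      exact (ih _ (hn ▸ hcard) (hstep.isCorrect_of_comp hW) (hfin.of_mono i) rfl).comp hact hpush
    · refine isTrace_of_position hfin (fun d hd => ⟨fun x => hcore ?_⟩) hW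
      obtain ⟨e, -, μ, hμ, -⟩ := exists_core x hd
      exact ⟨e, μ, hμ⟩

end PiTrace

theorem mainTheorem3 {Y U X : PiTrace.Psh}
    (hY : PiTrace.IsFinite Y) (hU : PiTrace.IsFinite U) (hX : PiTrace.IsFinite X)
    (s : Y ⟶ U) (t : X ⟶ U) (hs : CategoryTheory.Mono s) (ht : CategoryTheory.Mono t) :
    PiTrace.IsTrace s t ↔
      PiTrace.LocallyOneInjective U ∧
      PiTrace.ContainsExactlyInitial t ∧
      PiTrace.ContainsExactlyFinal s ∧
      (PiTrace.Linear (PiTrace.causalGraph U) ∧ PiTrace.Acyclic (PiTrace.causalGraph U)) := by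
  constructor
  · intro h
    have hc := h.isCorrect
    exact ⟨hc.loc, hc.init, hc.final, hc.linear, PiTrace.acyclic_of_wellFounded_later hc.wf⟩
  · rintro ⟨h1, h2, h3, h4, h5⟩
    exact PiTrace.IsCorrect.isTrace ⟨h1, h2, h3, h4, PiTrace.wellFounded_later hU h5⟩ hU
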